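/- **Type preservation for Core Remora.** The calculus is parametrised by a set of base types $B$, a set of base values $\mathfrak b$, each with a base type, and a set of primitive operators $\mathfrak o$, each with a closed well-kinded type of kind $\mathsf{Atom}$. Terms are considered up to renaming of bound variables, and substitution is capture-avoiding. *Indices.* $\iota ::= x \mid n \mid (\mathtt{Shp}\ \iota\ldots) \mid (+\ \iota\ldots) \mid (\mathbin{+\!\!+}\ \iota\ldots)$ with $n\in\mathbb N$. A sort environment $\Theta$ gives the sorts ($\mathsf{Dim}$ or $\mathsf{Shape}$) of the index variables. Naturals have sort $\mathsf{Dim}$; $(+\ \iota\ldots)$ has sort $\mathsf{Dim}$ and $(\mathtt{Shp}\ \iota\ldots)$ sort $\mathsf{Shape}$ if all components have sort $\mathsf{Dim}$; $(\mathbin{+\!\!+}\ \iota\ldots)$ has sort $\mathsf{Shape}$ if all components do. $\iota\cong\iota'$ means that both have the same sort under $\Theta$ and denote the same natural (sort $\mathsf{Dim}$) or the same finite sequence of naturals (sort $\mathsf{Shape}$) under every interpretation of the index variables. For shapes, $\iota\sqsubseteq\iota'$ means $(\mathbin{+\!\!+}\ \iota\ \iota'')\cong\iota'$ for some $\iota''$.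 *Types.* $\tau ::= x \mid B \mid (\mathtt{Arr}\ \tau\ \iota) \mid (\to (\tau\ldots)\ \tau') \mid (\forall\,((x\ k)\ldots)\ \tau) \mid (\Pi\,((x\ \gamma)\ldots)\ \tau) \mid (\Sigma\,((x\ \gamma)\ldots)\ \tau)$, where $k$ is a kind ($\mathsf{Atom}$ or $\mathsf{Array}$) and $\gamma$ a sort. A kind environment $\Delta$ gives the kinds of the type variables. Base types have kind $\mathsf{Atom}$; $(\mathtt{Arr}\ \tau\ \iota)$ has kind $\mathsf{Array}$ if $\tau$ has kind $\mathsf{Atom}$ and $\iota$ sort $\mathsf{Shape}$; function, $\forall$, $\Pi$ and $\Sigma$ types have kind $\mathsf{Atom}$ if their components (in the environments extended by the bound variables) have kind $\mathsf{Array}$. $\tau\cong\tau'$ is the congruence on types generated by $\cong$ on the indices in $\mathtt{Arr}$ types. *Terms.* Atoms: $a ::= \mathfrak b \mid \mathfrak o \mid (\lambda((x\ \tau)\ldots)\,e) \mid (\mathrm T\lambda((x\ k)\ldots)\,v) \mid (\mathrm I\lambda((x\ \gamma)\ldots)\,v) \mid (\mathtt{box}\ \iota\ldots\ e\ \tau)$.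 Expressions: $e ::= x \mid (\mathtt{array}\ (n\ldots)\ a\ldots) \mid (\mathtt{frame}\ (n\ldots)\ e\ldots) \mid (e\ e\ldots) \mid (\mathtt{t\text-app}\ e\ \tau\ldots) \mid (\mathtt{i\text-app}\ e\ \iota\ldots) \mid (\mathtt{unbox}\ (x_i\ldots\ x_e\ e_s)\ e_b)$. Every atom and expression is tagged with a type, on which type and index substitution act too; replacing a term variable replaces the whole tagged occurrence. Values $v$ are $\mathtt{array}$ forms all of whose atoms are atomic values, i.e. base values, operators, abstractions, or boxes with value content. *Typing* $\Theta;\Delta;\Gamma\vdash t:\tau$. In each of the following, apart from the first, the tag of $t$ must also be $\cong$ the ascribed type. - If $t:\tau'$ and $\tau\cong\tau'$ then $t:\tau$. - $x:\Gamma(x)$; a base value has its base type, an operator its given type. - $(\mathtt{array}\ (n\ldots)\ a\ldots):(\mathtt{Arr}\ \tau\ (\mathtt{Shp}\ n\ldots))$ if there are $\prod n$ atoms, all of type $\tau$, and $\tau$ has kind $\mathsf{Atom}$. - $(\mathtt{frame}\ (n\ldots)\ e\ldots):(\mathtt{Arr}\ \tau\ (\mathbin{+\!\!+}\ (\mathtt{Shp}\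 n\ldots)\ \iota))$ if there are $\prod n$ expressions, all of type $(\mathtt{Arr}\ \tau\ \iota)$, which has kind $\mathsf{Array}$. - $(e_f\ e_1\ldots e_m):(\mathtt{Arr}\ \tau'\ (\mathbin{+\!\!+}\ \iota_p\ \iota'))$ if $e_f:(\mathtt{Arr}\ (\to ((\mathtt{Arr}\ \tau_1\ \iota_1)\ldots(\mathtt{Arr}\ \tau_m\ \iota_m))\ (\mathtt{Arr}\ \tau'\ \iota'))\ \iota_f)$, each $e_j:(\mathtt{Arr}\ \tau_j\ (\mathbin{+\!\!+}\ \iota^a_j\ \iota_j))$, and the principal frame $\iota_p$ is one of $\iota_f,\iota^a_1,\ldots,\iota^a_m$ with all of them $\sqsubseteq\iota_p$. - $(\mathtt{t\text-app}\ e\ \tau\ldots):(\mathtt{Arr}\ \tau'[x\mapsto\tau,\ldots]\ (\mathbin{+\!\!+}\ \iota_f\ \iota'))$ if $e:(\mathtt{Arr}\ (\forall((x\ k)\ldots)(\mathtt{Arr}\ \tau'\ \iota'))\ \iota_f)$ and each $\tau$ has kind $k$; likewise $(\mathtt{i\text-app}\ e\ \iota\ldots):(\mathtt{Arr}\ \tau'[x\mapsto\iota,\ldots]\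 (\mathbin{+\!\!+}\ \iota_f\ \iota'[x\mapsto\iota,\ldots]))$ if $e:(\mathtt{Arr}\ (\Pi((x\ \gamma)\ldots)(\mathtt{Arr}\ \tau'\ \iota'))\ \iota_f)$ and each $\iota$ has sort $\gamma$. - $(\lambda((x\ \tau)\ldots)\,e):(\to(\tau\ldots)\ \tau')$ if every $\tau$ has kind $\mathsf{Array}$ and $e:\tau'$ with the $x:\tau$ added to $\Gamma$; $(\mathrm T\lambda((x\ k)\ldots)\,v):(\forall((x\ k)\ldots)\ \tau)$ and $(\mathrm I\lambda((x\ \gamma)\ldots)\,v):(\Pi((x\ \gamma)\ldots)\ \tau)$ if $v:\tau$ in the extended environment. - $(\mathtt{box}\ \iota\ldots\ e\ (\Sigma((x\ \gamma)\ldots)\ \tau)):(\Sigma((x\ \gamma)\ldots)\ \tau)$ if each $\iota$ has sort $\gamma$, the $\Sigma$ type has kind $\mathsf{Atom}$, and $e:\tau[x\mapsto\iota,\ldots]$. - $(\mathtt{unbox}\ (x_i\ldots\ x_e\ e_s)\ e_b):(\mathtt{Arr}\ \tau_b\ (\mathbin{+\!\!+}\ \iota_s\ \iota_b))$ if $e_s:(\mathtt{Arr}\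 (\Sigma((x_i\ \gamma)\ldots)\ \tau_s)\ \iota_s)$, $e_b:(\mathtt{Arr}\ \tau_b\ \iota_b)$ in the environments extended by $x_i:\gamma,\ldots$ and $x_e:\tau_s$, and $(\mathtt{Arr}\ \tau_b\ \iota_b)$ has kind $\mathsf{Array}$ in $\Theta,\Delta$ (so it does not mention the $x_i$). The environment $\Theta;\Delta;\Gamma$ is *well-formed* if every type in $\Gamma$ has kind $\mathsf{Array}$ under $\Theta,\Delta$. *List functions.* $\mathit{Split}_n$ cuts a list into consecutive pieces of length $n$, $\mathit{Rep}_n$ repeats every element $n$ times, $\mathit{Concat}$ concatenates a list of lists, $\mathit{Transpose}$ exchanges rows and columns of a list of equally long lists. *Reduction* $e\mapsto e'$. In an application of a function array with dimensions $n_f\ldots$, whose tag is $(\mathtt{Arr}\ (\to((\mathtt{Arr}\ \tau_j\ \iota_j)\ldots)\ \tau')\ \iota_f)$, to argument arrays, function and arguments being values, the dimensions of the $j$-th argument are of the form $n_j^a\ldots n_j\ldots$, with $\iota_j\cong(\mathtt{Shp}\ n_j\ldots)$; its frame is $n_j^a\ldots$ and its cell dimensions are $n_j\ldots$. - (lift)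 If the frames of function and arguments are not all equal, but all are prefixes of one of them, $n_p\ldots$, the application becomes the application of arrays that all have frame $n_p\ldots$: the atoms of each are $\mathit{Concat}(\mathit{Rep}_r(\mathit{Split}_c(\text{atoms})))$, where $c$ is the size of its cells ($1$ for the function) and $r$ the product of the dimensions of $n_p\ldots$ missing from its frame. - (map) If all frames are equal to a non-empty $n_f\ldots$, it becomes $(\mathtt{frame}\ (n_f\ldots)\ e\ldots)$, where $e\ldots$ are the applications of the single functions (as scalar arrays) to corresponding cells of the arguments, obtained by $\mathit{Transpose}$ from the $\mathit{Split}$ atom lists of the arguments; each is tagged $\tau'$. - ($\beta$, $\delta$) If all frames are empty and the function is $(\lambda((x\ \tau)\ldots)\,e)$, with as many parameters as arguments, the application becomes $e[x\mapsto v,\ldots]$; if it is a primitive operator, it becomes the result of the operator on the arguments, where defined. - (t$\beta$, i$\beta$) $(\mathtt{t\text-app}\ (\mathtt{array}\ (n\ldots)\ (\mathrm T\lambda((x\ k)\ldots)\,v)\ldots)\ \tau\ldots)\mapsto(\mathtt{frame}\ (n\ldots)\ v[x\mapsto\tau,\ldots]\ldots)$, and likewise for $\mathtt{i\text-app}$ and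 $\mathrm I\lambda$. - (unbox) $(\mathtt{unbox}\ (x_i\ldots\ x_e\ (\mathtt{array}\ (n\ldots)\ (\mathtt{box}\ \iota\ldots\ v\ \tau)\ldots))\ e_b)\mapsto(\mathtt{frame}\ (n\ldots)\ e_b[x_i\mapsto\iota,\ldots,x_e\mapsto v]\ldots)$. - (collapse) $(\mathtt{frame}\ (n\ldots)\ (\mathtt{array}\ (n'\ldots)\ a\ldots)\ldots)\mapsto(\mathtt{array}\ (n\ldots n'\ldots)\ \mathit{Concat}(a\ldots)\ldots)$ when all cells are values and the frame is tagged $(\mathtt{Arr}\ \tau\ \iota)$ with $\iota\cong(\mathtt{Shp}\ n\ldots n'\ldots)$. The contractum of every rule other than $\beta$ and $\delta$ keeps the tag of the redex. Reduction may also take place inside evaluation contexts: the content of a box in an array whose preceding atoms are values; a cell of a frame whose preceding cells are values; the function of an application, or an argument when the function and the preceding arguments are values; the head of a $\mathtt{t\text-app}$ or $\mathtt{i\text-app}$; the scrutinee of an $\mathtt{unbox}$. *Primitive operators* are assumed to be interpreted by partial functions such that, in every well-formed environment, whenever an operator of type $(\to(\tau\ldots)\ \tau')$ is defined on argument values of types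 $\tau\ldots$, its result has type $\tau'$. **Lemma (Preservation).** If the environment $\Theta;\Delta;\Gamma$ is well-formed, $\Theta;\Delta;\Gamma\vdash e:\tau$ and $e\mapsto e'$, then $\Theta;\Delta;\Gamma\vdash e':\tau$. -/

import Mathlib

/-! Core Remora, an explicitly typed rank-polymorphic array calculus.

Binders are represented by de Bruijn indices, with three separate name spaces: index variables,
type variables and term variables.  A form that binds a sequence of `n` variables binds the
variables `0, …, n - 1` of its body, in the order of the sequence; environments are lists, and
entry `x` of the list belongs to the variable `x`. -/

namespace Remora

universe u v w

/-! ### Type indices -/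

/-- Sorts of type indices. -/
inductive Srt where
  | dim
  | shape

/-- Kinds of types. -/
inductive Kind where
  | atom
  | array

/-- Type indices: variables, naturals, `(Shp ι ...)`, `(+ ι ...)` and `(++ ι ...)`. -/
inductive Idx where
  | var (x : ℕ)
  | nat (n : ℕ)
  | shp (ds : List Idx)
  | add (ds : List Idx)
  | append (ss : List Idx)

/-- The parallel substitution that replaces the first `ts.length` variables by the entries of `ts`
and lowers the remaining ones. -/
def instList {α : Type*} (var : ℕ → α) (ts : List α) : ℕ → α :=
  fun x => (ts[x]?).getD (var (x - ts.length))

/-- Parallel substitution of indices in an index. -/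
def Idx.subst (s : ℕ → Idx) : Idx → Idx
  | .var x => s x
  | .nat n => .nat n
  | .shp ds => .shp (ds.map (Idx.subst s))
  | .add ds => .add (ds.map (Idx.subst s))
  | .append ss => .append (ss.map (Idx.subst s))

/-- The substitution that makes room for `n` new index variables. -/
def Idx.shift (n : ℕ) : ℕ → Idx := fun x => .var (x + n)

/-- An index substitution pushed under a binder of `n` index variables. -/
def Idx.lift (n : ℕ) (s : ℕ → Idx) : ℕ → Idx :=
  fun x => if x < n then .var x else (s (x - n)).subst (Idx.shift n)

/-- The sorting judgment. -/
inductive Sorted (Θ : List Srt) : Idx → Srt → Prop where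
  | var {x : ℕ} {γ : Srt} (h : Θ[x]? = some γ) : Sorted Θ (.var x) γ
  | nat (n : ℕ) : Sorted Θ (.nat n) .dim
  | shp {ds : List Idx} (h : ∀ d ∈ ds, Sorted Θ d .dim) : Sorted Θ (.shp ds) .shape
  | add {ds : List Idx} (h : ∀ d ∈ ds, Sorted Θ d .dim) : Sorted Θ (.add ds) .dim
  | append {ss : List Idx} (h : ∀ s ∈ ss, Sorted Θ s .shape) : Sorted Θ (.append ss) .shape

/-- An interpretation of the index variables: variables of sort `Dim` are read as naturals by
`dim`, variables of sort `Shape` as sequences of naturals by `shape`. -/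
structure Interp where
  dim : ℕ → ℕ
  shape : ℕ → List ℕ

/-- The natural denoted by an index of sort `Dim` (meaningless on other indices). -/
def Idx.evalDim (ρ : Interp) : Idx → ℕ
  | .var x => ρ.dim x
  | .nat n => n
  | .shp _ => 0
  | .add ds => (ds.map (Idx.evalDim ρ)).sum
  | .append _ => 0

/-- The sequence denoted by an index of sort `Shape` (meaningless on other indices). -/
def Idx.evalShape (ρ : Interp) : Idx → List ℕ
  | .var x => ρ.shape x
  | .nat _ => []
  | .shp ds => ds.map (Idx.evalDim ρ)
  | .add _ => []
  | .append ss => (ss.map (Idx.evalShape ρ)).flatten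

/-- Validity of an equation between indices: both sides have the same sort, and they denote the
same natural, or the same element of the free monoid on `ℕ`, under every interpretation. -/
def IdxEqv (Θ : List Srt) (ι ι' : Idx) : Prop :=
  (Sorted Θ ι .dim ∧ Sorted Θ ι' .dim ∧ ∀ ρ, ι.evalDim ρ = ι'.evalDim ρ) ∨
  (Sorted Θ ι .shape ∧ Sorted Θ ι' .shape ∧ ∀ ρ, ι.evalShape ρ = ι'.evalShape ρ)

/-- The prefix order on shapes. -/
def IdxPrefix (Θ : List Srt) (ι ι' : Idx) : Prop :=
  ∃ w, IdxEqv Θ (.append [ι, w]) ι'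

/-- `ι` is the join of the shapes `ιs` in the prefix order (with a top added for incompatible
shapes, which is never `ι`): it is one of them, and all of them are prefixes of it. -/
def IsMaxFrame (Θ : List Srt) (ι : Idx) (ιs : List Idx) : Prop :=
  ι ∈ ιs ∧ ∀ ι' ∈ ιs, IdxPrefix Θ ι' ι

/-- The index `(Shp n ...)` for literal dimensions. -/
def shpLit (ns : List ℕ) : Idx := .shp (ns.map Idx.nat)

/-! ### Types -/

/-- Types, over a set `B` of base types. -/
inductive Ty (B : Type u) where
  | var (x : ℕ)
  | base (b : B)
  /-- `(Arr τ ι)` -/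
  | arr (τ : Ty B) (ι : Idx)
  /-- `(-> (τ ...) τ')` -/
  | fn (ins : List (Ty B)) (out : Ty B)
  /-- `(Forall ((x k) ...) τ)` -/
  | univ (ks : List Kind) (body : Ty B)
  /-- `(Pi ((x γ) ...) τ)` -/
  | pi (γs : List Srt) (body : Ty B)
  /-- `(Sigma ((x γ) ...) τ)` -/
  | sigma (γs : List Srt) (body : Ty B)

section Types

variable {B : Type u}

/-- Parallel substitution of indices in a type. -/
def Ty.isubst (s : ℕ → Idx) : Ty B → Ty B
  | .var x => .var x
  | .base b => .base b
  | .arr τ ι => .arr (τ.isubst s) (ι.subst s)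
  | .fn ins out => .fn (ins.map (Ty.isubst s)) (out.isubst s)
  | .univ ks τ => .univ ks (τ.isubst s)
  | .pi γs τ => .pi γs (τ.isubst (Idx.lift γs.length s))
  | .sigma γs τ => .sigma γs (τ.isubst (Idx.lift γs.length s))

/-- Renaming of type variables in a type. -/
def Ty.trename (r : ℕ → ℕ) : Ty B → Ty B
  | .var x => .var (r x)
  | .base b => .base b
  | .arr τ ι => .arr (τ.trename r) ι
  | .fn ins out => .fn (ins.map (Ty.trename r)) (out.trename r)
  | .univ ks τ =>
      .univ ks (τ.trename fun x => if x < ks.length then x else r (x - ks.length) + ks.length)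
  | .pi γs τ => .pi γs (τ.trename r)
  | .sigma γs τ => .sigma γs (τ.trename r)

/-- A type substitution pushed under a binder of `n` type variables. -/
def Ty.lift (n : ℕ) (s : ℕ → Ty B) : ℕ → Ty B :=
  fun x => if x < n then .var x else (s (x - n)).trename (· + n)

/-- Parallel substitution of types in a type. -/
def Ty.tsubst (s : ℕ → Ty B) : Ty B → Ty B
  | .var x => s x
  | .base b => .base b
  | .arr τ ι => .arr (τ.tsubst s) ι
  | .fn ins out => .fn (ins.map (Ty.tsubst s)) (out.tsubst s)
  | .univ ks τ => .univ ks (τ.tsubst (Ty.lift ks.length s))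
  | .pi γs τ => .pi γs (τ.tsubst fun x => (s x).isubst (Idx.shift γs.length))
  | .sigma γs τ => .sigma γs (τ.tsubst fun x => (s x).isubst (Idx.shift γs.length))

/-- The substitution that makes room for `n` new type variables. -/
def Ty.shift (n : ℕ) : ℕ → Ty B := fun x => .var (x + n)

/-- The kinding judgment. -/
inductive Kinded : List Srt → List Kind → Ty B → Kind → Prop where
  | var {Θ : List Srt} {Δ : List Kind} {x : ℕ} {k : Kind} (h : Δ[x]? = some k) :
      Kinded Θ Δ (.var x) k
  | base {Θ : List Srt} {Δ : List Kind} (b : B) : Kinded Θ Δ (.base b) .atom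
  | arr {Θ : List Srt} {Δ : List Kind} {τ : Ty B} {ι : Idx}
      (hτ : Kinded Θ Δ τ .atom) (hι : Sorted Θ ι .shape) : Kinded Θ Δ (.arr τ ι) .array
  | fn {Θ : List Srt} {Δ : List Kind} {ins : List (Ty B)} {out : Ty B}
      (hi : ∀ τ ∈ ins, Kinded Θ Δ τ .array) (ho : Kinded Θ Δ out .array) :
      Kinded Θ Δ (.fn ins out) .atom
  | univ {Θ : List Srt} {Δ ks : List Kind} {τ : Ty B}
      (h : Kinded Θ (ks ++ Δ) τ .array) : Kinded Θ Δ (.univ ks τ) .atom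
  | pi {Θ γs : List Srt} {Δ : List Kind} {τ : Ty B}
      (h : Kinded (γs ++ Θ) Δ τ .array) : Kinded Θ Δ (.pi γs τ) .atom
  | sigma {Θ γs : List Srt} {Δ : List Kind} {τ : Ty B}
      (h : Kinded (γs ++ Θ) Δ τ .array) : Kinded Θ Δ (.sigma γs τ) .atom

/-- Type equivalence.  The environment records the sorts of the free index variables, which decide
what it means for an equation between indices to be valid.  Renaming of bound variables is built
into the representation. -/
inductive TEqv : List Srt → Ty B → Ty B → Prop where
  | refl {Θ : List Srt} (τ : Ty B) : TEqv Θ τ τ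
  | arr {Θ : List Srt} {τ τ' : Ty B} {ι ι' : Idx}
      (hτ : TEqv Θ τ τ') (hι : IdxEqv Θ ι ι') : TEqv Θ (.arr τ ι) (.arr τ' ι')
  | fn {Θ : List Srt} {ins ins' : List (Ty B)} {out out' : Ty B}
      (hl : ins.length = ins'.length)
      (hi : ∀ (i : ℕ) (τ τ' : Ty B), ins[i]? = some τ → ins'[i]? = some τ' → TEqv Θ τ τ')
      (ho : TEqv Θ out out') : TEqv Θ (.fn ins out) (.fn ins' out')
  | univ {Θ : List Srt} {ks : List Kind} {τ τ' : Ty B}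
      (h : TEqv Θ τ τ') : TEqv Θ (.univ ks τ) (.univ ks τ')
  | pi {Θ γs : List Srt} {τ τ' : Ty B}
      (h : TEqv (γs ++ Θ) τ τ') : TEqv Θ (.pi γs τ) (.pi γs τ')
  | sigma {Θ γs : List Srt} {τ τ' : Ty B}
      (h : TEqv (γs ++ Θ) τ τ') : TEqv Θ (.sigma γs τ) (.sigma γs τ')

end Types

/-! ### Terms

Every atom and every expression carries, as its last component, the type it is tagged with.  As
the tags determine the element type of an array or frame without entries, there are no separate
forms for empty arrays and empty frames. -/

mutual

/-- Expressions, over base types `B`, base values `V` and primitive operators `O`. -/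
inductive Expr (B : Type u) (V : Type v) (O : Type w) where
  | var (x : ℕ) (tag : Ty B)
  /-- `(array (n ...) a ...)` -/
  | array (dims : List ℕ) (atoms : List (Atom B V O)) (tag : Ty B)
  /-- `(frame (n ...) e ...)` -/
  | frame (dims : List ℕ) (cells : List (Expr B V O)) (tag : Ty B)
  /-- `(e e ...)` -/
  | app (f : Expr B V O) (args : List (Expr B V O)) (tag : Ty B)
  /-- `(t-app e τ ...)` -/
  | tapp (f : Expr B V O) (τs : List (Ty B)) (tag : Ty B)
  /-- `(i-app e ι ...)` -/
  | iapp (f : Expr B V O) (ιs : List Idx) (tag : Ty B)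
  /-- `(unbox (x_i ... x_e e_s) e_b)`, binding `n` index variables and one term variable in
  the body -/
  | unbox (n : ℕ) (scrut : Expr B V O) (body : Expr B V O) (tag : Ty B)

/-- Atoms. -/
inductive Atom (B : Type u) (V : Type v) (O : Type w) where
  | base (b : V) (tag : Ty B)
  | op (o : O) (tag : Ty B)
  /-- `(λ ((x τ) ...) e)` -/
  | lam (τs : List (Ty B)) (body : Expr B V O) (tag : Ty B)
  /-- `(Tλ ((x k) ...) v)` -/
  | tlam (ks : List Kind) (body : Expr B V O) (tag : Ty B)
  /-- `(Iλ ((x γ) ...) v)` -/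
  | ilam (γs : List Srt) (body : Expr B V O) (tag : Ty B)
  /-- `(box ι ... e τ)` -/
  | box (ιs : List Idx) (e : Expr B V O) (τ : Ty B) (tag : Ty B)

end

/-- Terms: expressions and atoms. -/
inductive Term (B : Type u) (V : Type v) (O : Type w) where
  | expr (e : Expr B V O)
  | atom (a : Atom B V O)

section Terms

variable {B : Type u} {V : Type v} {O : Type w}

/-- Values: array literals all of whose atoms are atomic values. -/
inductive IsValue : Term B V O → Prop where
  | array {dims : List ℕ} {atoms : List (Atom B V O)} {tag : Ty B}
      (h : ∀ a ∈ atoms, IsValue (.atom a)) : IsValue (.expr (.array dims atoms tag))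
  | base (b : V) (tag : Ty B) : IsValue (.atom (.base b tag))
  | op (o : O) (tag : Ty B) : IsValue (.atom (.op o tag))
  | lam (τs : List (Ty B)) (body : Expr B V O) (tag : Ty B) : IsValue (.atom (.lam τs body tag))
  | tlam {ks : List Kind} {body : Expr B V O} {tag : Ty B}
      (h : IsValue (.expr body)) : IsValue (.atom (.tlam ks body tag))
  | ilam {γs : List Srt} {body : Expr B V O} {tag : Ty B}
      (h : IsValue (.expr body)) : IsValue (.atom (.ilam γs body tag))
  | box {ιs : List Idx} {e : Expr B V O} {τ tag : Ty B}
      (h : IsValue (.expr e)) : IsValue (.atom (.box ιs e τ tag))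

mutual

/-- Parallel substitution of indices in an expression (including its tags). -/
def Expr.isubst (s : ℕ → Idx) : Expr B V O → Expr B V O
  | .var x t => .var x (t.isubst s)
  | .array ns as t => .array ns (as.map (Atom.isubst s)) (t.isubst s)
  | .frame ns es t => .frame ns (es.map (Expr.isubst s)) (t.isubst s)
  | .app f es t => .app (f.isubst s) (es.map (Expr.isubst s)) (t.isubst s)
  | .tapp f τs t => .tapp (f.isubst s) (τs.map (Ty.isubst s)) (t.isubst s)
  | .iapp f ιs t => .iapp (f.isubst s) (ιs.map (Idx.subst s)) (t.isubst s)
  | .unbox n e b t => .unbox n (e.isubst s) (b.isubst (Idx.lift n s)) (t.isubst s)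

/-- Parallel substitution of indices in an atom. -/
def Atom.isubst (s : ℕ → Idx) : Atom B V O → Atom B V O
  | .base b t => .base b (t.isubst s)
  | .op o t => .op o (t.isubst s)
  | .lam τs e t => .lam (τs.map (Ty.isubst s)) (e.isubst s) (t.isubst s)
  | .tlam ks e t => .tlam ks (e.isubst s) (t.isubst s)
  | .ilam γs e t => .ilam γs (e.isubst (Idx.lift γs.length s)) (t.isubst s)
  | .box ιs e τ t => .box (ιs.map (Idx.subst s)) (e.isubst s) (τ.isubst s) (t.isubst s)

end

mutual

/-- Parallel substitution of types in an expression (including its tags). -/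
def Expr.tsubst (s : ℕ → Ty B) : Expr B V O → Expr B V O
  | .var x t => .var x (t.tsubst s)
  | .array ns as t => .array ns (as.map (Atom.tsubst s)) (t.tsubst s)
  | .frame ns es t => .frame ns (es.map (Expr.tsubst s)) (t.tsubst s)
  | .app f es t => .app (f.tsubst s) (es.map (Expr.tsubst s)) (t.tsubst s)
  | .tapp f τs t => .tapp (f.tsubst s) (τs.map (Ty.tsubst s)) (t.tsubst s)
  | .iapp f ιs t => .iapp (f.tsubst s) ιs (t.tsubst s)
  | .unbox n e b t =>
      .unbox n (e.tsubst s) (b.tsubst fun x => (s x).isubst (Idx.shift n)) (t.tsubst s)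

/-- Parallel substitution of types in an atom. -/
def Atom.tsubst (s : ℕ → Ty B) : Atom B V O → Atom B V O
  | .base b t => .base b (t.tsubst s)
  | .op o t => .op o (t.tsubst s)
  | .lam τs e t => .lam (τs.map (Ty.tsubst s)) (e.tsubst s) (t.tsubst s)
  | .tlam ks e t => .tlam ks (e.tsubst (Ty.lift ks.length s)) (t.tsubst s)
  | .ilam γs e t =>
      .ilam γs (e.tsubst fun x => (s x).isubst (Idx.shift γs.length)) (t.tsubst s)
  | .box ιs e τ t => .box ιs (e.tsubst s) (τ.tsubst s) (t.tsubst s)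

end

/-- A renaming pushed under a binder of `n` variables. -/
def liftRen (n : ℕ) (r : ℕ → ℕ) : ℕ → ℕ := fun x => if x < n then x else r (x - n) + n

mutual

/-- Renaming of term variables in an expression. -/
def Expr.rename (r : ℕ → ℕ) : Expr B V O → Expr B V O
  | .var x t => .var (r x) t
  | .array ns as t => .array ns (as.map (Atom.rename r)) t
  | .frame ns es t => .frame ns (es.map (Expr.rename r)) t
  | .app f es t => .app (f.rename r) (es.map (Expr.rename r)) t
  | .tapp f τs t => .tapp (f.rename r) τs t
  | .iapp f ιs t => .iapp (f.rename r) ιs t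
  | .unbox n e b t => .unbox n (e.rename r) (b.rename (liftRen 1 r)) t

/-- Renaming of term variables in an atom. -/
def Atom.rename (r : ℕ → ℕ) : Atom B V O → Atom B V O
  | .base b t => .base b t
  | .op o t => .op o t
  | .lam τs e t => .lam τs (e.rename (liftRen τs.length r)) t
  | .tlam ks e t => .tlam ks (e.rename r) t
  | .ilam γs e t => .ilam γs (e.rename r) t
  | .box ιs e τ t => .box ιs (e.rename r) τ t

end

/-- A substitution for term variables.  A variable that is not replaced (`inl`) keeps the tag of
its occurrence; a variable that is replaced (`inr`) takes the tag of the replacement. -/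
abbrev TermSubst (B : Type u) (V : Type v) (O : Type w) := ℕ → ℕ ⊕ Expr B V O

/-- A substitution for term variables pushed under a binder of `n` term variables. -/
def TermSubst.lift (n : ℕ) (s : TermSubst B V O) : TermSubst B V O :=
  fun x => if x < n then .inl x else (s (x - n)).map (· + n) (Expr.rename (· + n))

/-- A substitution for term variables pushed under a binder of `n` index variables. -/
def TermSubst.ilift (n : ℕ) (s : TermSubst B V O) : TermSubst B V O :=
  fun x => (s x).map id (Expr.isubst (Idx.shift n))

/-- A substitution for term variables pushed under a binder of `n` type variables. -/
def TermSubst.tlift (n : ℕ) (s : TermSubst B V O) : TermSubst B V O :=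
  fun x => (s x).map id (Expr.tsubst (Ty.shift n))

mutual

/-- Parallel substitution of expressions for term variables in an expression. -/
def Expr.subst (s : TermSubst B V O) : Expr B V O → Expr B V O
  | .var x t => Sum.elim (fun y => .var y t) id (s x)
  | .array ns as t => .array ns (as.map (Atom.subst s)) t
  | .frame ns es t => .frame ns (es.map (Expr.subst s)) t
  | .app f es t => .app (f.subst s) (es.map (Expr.subst s)) t
  | .tapp f τs t => .tapp (f.subst s) τs t
  | .iapp f ιs t => .iapp (f.subst s) ιs t
  | .unbox n e b t =>
      .unbox n (e.subst s) (b.subst (TermSubst.lift 1 (TermSubst.ilift n s))) t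

/-- Parallel substitution of expressions for term variables in an atom. -/
def Atom.subst (s : TermSubst B V O) : Atom B V O → Atom B V O
  | .base b t => .base b t
  | .op o t => .op o t
  | .lam τs e t => .lam τs (e.subst (TermSubst.lift τs.length s)) t
  | .tlam ks e t => .tlam ks (e.subst (TermSubst.tlift ks.length s)) t
  | .ilam γs e t => .ilam γs (e.subst (TermSubst.ilift γs.length s)) t
  | .box ιs e τ t => .box ιs (e.subst s) τ t

end

/-- Instantiation of the outermost `ιs.length` index variables of a type. -/
def Ty.iinst (τ : Ty B) (ιs : List Idx) : Ty B := τ.isubst (instList Idx.var ιs)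

/-- Instantiation of the outermost `τs.length` type variables of a type. -/
def Ty.tinst (τ : Ty B) (τs : List (Ty B)) : Ty B := τ.tsubst (instList Ty.var τs)

/-- Instantiation of the outermost `ιs.length` index variables of an expression. -/
def Expr.iinst (e : Expr B V O) (ιs : List Idx) : Expr B V O := e.isubst (instList Idx.var ιs)

/-- Instantiation of the outermost `τs.length` type variables of an expression. -/
def Expr.tinst (e : Expr B V O) (τs : List (Ty B)) : Expr B V O := e.tsubst (instList Ty.var τs)

/-- Instantiation of the outermost `es.length` term variables of an expression. -/
def Expr.inst (e : Expr B V O) (es : List (Expr B V O)) : Expr B V O :=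
  e.subst (instList Sum.inl (es.map Sum.inr))

end Terms

/-! ### Typing -/

/-- The types of the base values and of the primitive operators; the latter are closed and
well-kinded. -/
structure Signature (B : Type u) (V : Type v) (O : Type w) where
  baseTy : V → B
  opTy : O → Ty B
  opTy_kinded : ∀ o, Kinded [] [] (opTy o) .atom

/-- The data of one argument position of an application: atom type `elt` and cell shape `cell` that
the function expects, and frame `frame` of the actual argument. -/
structure ArgTy (B : Type u) where
  elt : Ty B
  cell : Idx
  frame : Idx

section Typing

variable {B : Type u} {V : Type v} {O : Type w}

/-- The type `(Arr τ ι)` expected at an argument position. -/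
def ArgTy.param (p : ArgTy B) : Ty B := .arr p.elt p.cell

/-- The type of the actual argument, with its frame in front of the cell shape. -/
def ArgTy.actual (p : ArgTy B) : Ty B := .arr p.elt (.append [p.frame, p.cell])

/-- The typing judgment for tagged terms.  Each rule other than `eqv` also demands that the tag of
the term agree, up to equivalence, with the type that the rule ascribes. -/
inductive HasType (S : Signature B V O) :
    List Srt → List Kind → List (Ty B) → Term B V O → Ty B → Prop where
  | eqv {Θ : List Srt} {Δ : List Kind} {Γ : List (Ty B)} {t : Term B V O} {τ τ' : Ty B}
      (h : HasType S Θ Δ Γ t τ') (he : TEqv Θ τ τ') : HasType S Θ Δ Γ t τ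
  | var {Θ : List Srt} {Δ : List Kind} {Γ : List (Ty B)} {x : ℕ} {τ tag : Ty B}
      (h : Γ[x]? = some τ) (htag : TEqv Θ tag τ) :
      HasType S Θ Δ Γ (.expr (.var x tag)) τ
  | array {Θ : List Srt} {Δ : List Kind} {Γ : List (Ty B)} {ns : List ℕ}
      {as : List (Atom B V O)} {τ tag : Ty B}
      (ha : ∀ a ∈ as, HasType S Θ Δ Γ (.atom a) τ)
      (hk : Kinded Θ Δ τ .atom)
      (hl : as.length = ns.prod)
      (htag : TEqv Θ tag (.arr τ (shpLit ns))) :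
      HasType S Θ Δ Γ (.expr (.array ns as tag)) (.arr τ (shpLit ns))
  | frame {Θ : List Srt} {Δ : List Kind} {Γ : List (Ty B)} {ns : List ℕ}
      {es : List (Expr B V O)} {τ tag : Ty B} {ι : Idx}
      (he : ∀ e ∈ es, HasType S Θ Δ Γ (.expr e) (.arr τ ι))
      (hk : Kinded Θ Δ (.arr τ ι) .array)
      (hl : es.length = ns.prod)
      (htag : TEqv Θ tag (.arr τ (.append [shpLit ns, ι]))) :
      HasType S Θ Δ Γ (.expr (.frame ns es tag)) (.arr τ (.append [shpLit ns, ι]))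
  | app {Θ : List Srt} {Δ : List Kind} {Γ : List (Ty B)} {f : Expr B V O}
      {es : List (Expr B V O)} {ps : List (ArgTy B)} {τo tag : Ty B} {ιo ιf ιp : Idx}
      (hf : HasType S Θ Δ Γ (.expr f) (.arr (.fn (ps.map ArgTy.param) (.arr τo ιo)) ιf))
      (hl : es.length = ps.length)
      (he : ∀ (i : ℕ) (e : Expr B V O) (p : ArgTy B), es[i]? = some e → ps[i]? = some p →
        HasType S Θ Δ Γ (.expr e) p.actual)
      (hp : IsMaxFrame Θ ιp (ιf :: ps.map ArgTy.frame))
      (htag : TEqv Θ tag (.arr τo (.append [ιp, ιo]))) :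
      HasType S Θ Δ Γ (.expr (.app f es tag)) (.arr τo (.append [ιp, ιo]))
  | tapp {Θ : List Srt} {Δ : List Kind} {Γ : List (Ty B)} {f : Expr B V O}
      {τs : List (Ty B)} {ks : List Kind} {τu tag : Ty B} {ιu ιf : Idx}
      (hf : HasType S Θ Δ Γ (.expr f) (.arr (.univ ks (.arr τu ιu)) ιf))
      (ha : List.Forall₂ (Kinded Θ Δ) τs ks)
      (htag : TEqv Θ tag (.arr (τu.tinst τs) (.append [ιf, ιu]))) :
      HasType S Θ Δ Γ (.expr (.tapp f τs tag)) (.arr (τu.tinst τs) (.append [ιf, ιu]))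
  | iapp {Θ : List Srt} {Δ : List Kind} {Γ : List (Ty B)} {f : Expr B V O}
      {ιs : List Idx} {γs : List Srt} {τp tag : Ty B} {ιp ιf : Idx}
      (hf : HasType S Θ Δ Γ (.expr f) (.arr (.pi γs (.arr τp ιp)) ιf))
      (ha : List.Forall₂ (Sorted Θ) ιs γs)
      (htag : TEqv Θ tag
        (.arr (τp.iinst ιs) (.append [ιf, ιp.subst (instList Idx.var ιs)]))) :
      HasType S Θ Δ Γ (.expr (.iapp f ιs tag))
        (.arr (τp.iinst ιs) (.append [ιf, ιp.subst (instList Idx.var ιs)]))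
  | unbox {Θ : List Srt} {Δ : List Kind} {Γ : List (Ty B)} {n : ℕ} {s b : Expr B V O}
      {γs : List Srt} {τs τb tag : Ty B} {ιs ιb : Idx}
      (hs : HasType S Θ Δ Γ (.expr s) (.arr (.sigma γs τs) ιs))
      (hn : n = γs.length)
      (hb : HasType S (γs ++ Θ) Δ (τs :: Γ.map (Ty.isubst (Idx.shift n))) (.expr b)
        ((Ty.arr τb ιb).isubst (Idx.shift n)))
      (hk : Kinded Θ Δ (.arr τb ιb) .array)
      (htag : TEqv Θ tag (.arr τb (.append [ιs, ιb]))) :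
      HasType S Θ Δ Γ (.expr (.unbox n s b tag)) (.arr τb (.append [ιs, ιb]))
  | base {Θ : List Srt} {Δ : List Kind} {Γ : List (Ty B)} {b : V} {tag : Ty B}
      (htag : TEqv Θ tag (.base (S.baseTy b))) :
      HasType S Θ Δ Γ (.atom (.base b tag)) (.base (S.baseTy b))
  | op {Θ : List Srt} {Δ : List Kind} {Γ : List (Ty B)} {o : O} {tag : Ty B}
      (htag : TEqv Θ tag (S.opTy o)) :
      HasType S Θ Δ Γ (.atom (.op o tag)) (S.opTy o)
  | lam {Θ : List Srt} {Δ : List Kind} {Γ τs : List (Ty B)} {e : Expr B V O} {τo tag : Ty B}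
      (he : HasType S Θ Δ (τs ++ Γ) (.expr e) τo)
      (hk : ∀ τ ∈ τs, Kinded Θ Δ τ .array)
      (htag : TEqv Θ tag (.fn τs τo)) :
      HasType S Θ Δ Γ (.atom (.lam τs e tag)) (.fn τs τo)
  | tlam {Θ : List Srt} {Δ ks : List Kind} {Γ : List (Ty B)} {e : Expr B V O} {τ tag : Ty B}
      (hv : IsValue (.expr e))
      (he : HasType S Θ (ks ++ Δ) (Γ.map (Ty.tsubst (Ty.shift ks.length))) (.expr e) τ)
      (htag : TEqv Θ tag (.univ ks τ)) :
      HasType S Θ Δ Γ (.atom (.tlam ks e tag)) (.univ ks τ)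
  | ilam {Θ γs : List Srt} {Δ : List Kind} {Γ : List (Ty B)} {e : Expr B V O} {τ tag : Ty B}
      (hv : IsValue (.expr e))
      (he : HasType S (γs ++ Θ) Δ (Γ.map (Ty.isubst (Idx.shift γs.length))) (.expr e) τ)
      (htag : TEqv Θ tag (.pi γs τ)) :
      HasType S Θ Δ Γ (.atom (.ilam γs e tag)) (.pi γs τ)
  | box {Θ γs : List Srt} {Δ : List Kind} {Γ : List (Ty B)} {ιs : List Idx} {e : Expr B V O}
      {τs tag : Ty B}
      (hι : List.Forall₂ (Sorted Θ) ιs γs)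
      (hk : Kinded Θ Δ (.sigma γs τs) .atom)
      (he : HasType S Θ Δ Γ (.expr e) (τs.iinst ιs))
      (htag : TEqv Θ tag (.sigma γs τs)) :
      HasType S Θ Δ Γ (.atom (.box ιs e (.sigma γs τs) tag)) (.sigma γs τs)

/-- Well-formed environments: term variables stand for arrays. -/
def WfEnv (Θ : List Srt) (Δ : List Kind) (Γ : List (Ty B)) : Prop :=
  ∀ τ ∈ Γ, Kinded Θ Δ τ .array

/-- A family of partial functions interpreting the primitive operators is sound if, on argument
values of the operator's input types, every result inhabits the operator's output type. -/
def DeltaSound (S : Signature B V O) (δ : O → List (Expr B V O) → Option (Expr B V O)) : Prop :=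
  ∀ (Θ : List Srt) (Δ : List Kind) (Γ : List (Ty B)) (o : O) (ins : List (Ty B)) (out : Ty B)
    (vs : List (Expr B V O)) (r : Expr B V O),
    WfEnv Θ Δ Γ → S.opTy o = .fn ins out →
    (∀ v ∈ vs, IsValue (.expr v)) →
    List.Forall₂ (fun v τ => HasType S Θ Δ Γ (.expr v) τ) vs ins →
    δ o vs = some r → HasType S Θ Δ Γ (.expr r) out

end Typing

/-! ### Reduction -/

section Lists

variable {α : Type*}

/-- `Split`: the list of the `k` consecutive pieces of length `n` of a list of length `k * n`.  The
number of pieces is given explicitly since it is not determined by the list when `n = 0`. -/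
def split (k n : ℕ) (l : List α) : List (List α) :=
  (List.range k).map fun j => (l.drop (j * n)).take n

/-- `Rep`: every element repeated `n` times. -/
def rep (n : ℕ) (l : List α) : List α := l.flatMap (List.replicate n)

/-- `Concat`: the concatenation of a list of lists. -/
def concat (l : List (List α)) : List α := l.flatten

/-- `Transpose` of a list of lists of length `m`: the `j`-th entry is the list of the `j`-th
elements of the given lists.  The length `m` is given explicitly since it is not determined by an
empty list of lists. -/
def transpose (m : ℕ) (ls : List (List α)) : List (List α) :=
  (List.range m).map fun j => ls.filterMap fun l => l[j]?

end Lists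

/-- An argument array value of an application, seen from its argument position: its dimensions are
split into frame and cell dimensions, and `(Arr elt shape)` is the corresponding input type in the
tag of the function array. -/
structure ArrArg (B : Type u) (V : Type v) (O : Type w) where
  frame : List ℕ
  cell : List ℕ
  atoms : List (Atom B V O)
  tag : Ty B
  elt : Ty B
  shape : Idx

section Reduction

variable {B : Type u} {V : Type v} {O : Type w}

/-- The argument array itself. -/
def ArrArg.expr (a : ArrArg B V O) : Expr B V O := .array (a.frame ++ a.cell) a.atoms a.tag

/-- The function's input type at this position. -/
def ArrArg.param (a : ArrArg B V O) : Ty B := .arr a.elt a.shape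

/-- The argument is a value, and its cell dimensions are those of the function's input type. -/
def ArrArg.Ok (a : ArrArg B V O) : Prop :=
  (∀ x ∈ a.atoms, IsValue (.atom x)) ∧ IdxEqv [] a.shape (shpLit a.cell)

/-- The argument with its cells replicated so as to have the frame `np`. -/
def ArrArg.lifted (np : List ℕ) (a : ArrArg B V O) : Expr B V O :=
  .array (np ++ a.cell)
    (concat (rep (np.drop a.frame.length).prod (split a.frame.prod a.cell.prod a.atoms)))
    (.arr a.elt (shpLit (np ++ a.cell)))

/-- The array made of the atoms `x` of one cell of the argument. -/
def ArrArg.cellExpr (a : ArrArg B V O) (x : List (Atom B V O)) : Expr B V O :=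
  .array a.cell x (.arr a.elt (shpLit a.cell))

/-- The application forms, one per cell of the common frame `nf`, that result from mapping the
functions `fs`, of type `(-> (a.param ...) out)`, over the cells of the arguments. -/
def mapCells (nf : List ℕ) (fs : List (Atom B V O)) (args : List (ArrArg B V O)) (out : Ty B) :
    List (Expr B V O) :=
  List.zipWith
    (fun f xs =>
      .app (.array [] [f] (.arr (.fn (args.map ArrArg.param) out) (shpLit [])))
        (List.zipWith ArrArg.cellExpr args xs) out)
    fs (transpose nf.prod (args.map fun a => split nf.prod a.cell.prod a.atoms))

/-- Small-step call-by-value reduction.  The first eight rules contract redexes, the others perform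
a step inside an evaluation context. -/
inductive Step (δ : O → List (Expr B V O) → Option (Expr B V O)) :
    Expr B V O → Expr B V O → Prop where
  | lift {nf np : List ℕ} {fs : List (Atom B V O)} {args : List (ArrArg B V O)}
      {out tag : Ty B} {ιf : Idx}
      (hfs : ∀ f ∈ fs, IsValue (.atom f)) (hargs : ∀ a ∈ args, a.Ok)
      (hmem : np ∈ nf :: args.map ArrArg.frame)
      (hmax : ∀ n ∈ nf :: args.map ArrArg.frame, n <+: np)
      (hne : ∃ n ∈ nf :: args.map ArrArg.frame, n ≠ np) :
      Step δ
        (.app (.array nf fs (.arr (.fn (args.map ArrArg.param) out) ιf))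
          (args.map ArrArg.expr) tag)
        (.app
          (.array np (concat (rep (np.drop nf.length).prod (split nf.prod 1 fs)))
            (.arr (.fn (args.map ArrArg.param) out) (shpLit np)))
          (args.map (ArrArg.lifted np)) tag)
  | map {nf : List ℕ} {fs : List (Atom B V O)} {args : List (ArrArg B V O)}
      {out tag : Ty B} {ιf : Idx}
      (hfs : ∀ f ∈ fs, IsValue (.atom f)) (hargs : ∀ a ∈ args, a.Ok)
      (hframe : ∀ a ∈ args, a.frame = nf) (hnf : nf ≠ []) :
      Step δ
        (.app (.array nf fs (.arr (.fn (args.map ArrArg.param) out) ιf))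
          (args.map ArrArg.expr) tag)
        (.frame nf (mapCells nf fs args out) tag)
  | beta {τs : List (Ty B)} {e : Expr B V O} {args : List (ArrArg B V O)}
      {out tag tag' : Ty B} {ιf : Idx}
      (hl : τs.length = args.length) (hargs : ∀ a ∈ args, a.Ok)
      (hframe : ∀ a ∈ args, a.frame = []) :
      Step δ
        (.app (.array [] [.lam τs e tag'] (.arr (.fn (args.map ArrArg.param) out) ιf))
          (args.map ArrArg.expr) tag)
        (e.inst (args.map ArrArg.expr))
  | delta {o : O} {args : List (ArrArg B V O)} {out tag tag' : Ty B} {ιf : Idx}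
      {r : Expr B V O}
      (hargs : ∀ a ∈ args, a.Ok) (hframe : ∀ a ∈ args, a.frame = [])
      (hr : δ o (args.map ArrArg.expr) = some r) :
      Step δ
        (.app (.array [] [.op o tag'] (.arr (.fn (args.map ArrArg.param) out) ιf))
          (args.map ArrArg.expr) tag)
        r
  | tbeta {nf : List ℕ} {fs : List (Atom B V O)} {cells : List (Expr B V O)}
      {τs : List (Ty B)} {tag tag' : Ty B}
      (h : List.Forall₂ (fun f c => ∃ ks e t, f = Atom.tlam ks e t ∧
        ks.length = τs.length ∧ c = e.tinst τs) fs cells) :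
      Step δ (.tapp (.array nf fs tag') τs tag) (.frame nf cells tag)
  | ibeta {nf : List ℕ} {fs : List (Atom B V O)} {cells : List (Expr B V O)}
      {ιs : List Idx} {tag tag' : Ty B}
      (h : List.Forall₂ (fun f c => ∃ γs e t, f = Atom.ilam γs e t ∧
        γs.length = ιs.length ∧ c = e.iinst ιs) fs cells) :
      Step δ (.iapp (.array nf fs tag') ιs tag) (.frame nf cells tag)
  | unbox {ns : List ℕ} {bs : List (Atom B V O)} {cells : List (Expr B V O)} {n : ℕ}
      {b : Expr B V O} {tag tag' : Ty B}
      (h : List.Forall₂ (fun a c => ∃ ιs v τ t, a = Atom.box ιs v τ t ∧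
        IsValue (.expr v) ∧ ιs.length = n ∧ c = (b.iinst ιs).inst [v]) bs cells) :
      Step δ (.unbox n (.array ns bs tag') b tag) (.frame ns cells tag)
  | collapse {nf nc : List ℕ} {cells : List (Expr B V O)} {ass : List (List (Atom B V O))}
      {τ : Ty B} {ι : Idx}
      (hι : IdxEqv [] ι (shpLit (nf ++ nc)))
      (h : List.Forall₂ (fun c as => ∃ t, c = Expr.array nc as t ∧
        ∀ a ∈ as, IsValue (.atom a)) cells ass) :
      Step δ (.frame nf cells (.arr τ ι)) (.array (nf ++ nc) (concat ass) (.arr τ ι))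
  | inBox {ns : List ℕ} {as as' : List (Atom B V O)} {ιs : List Idx} {e e' : Expr B V O}
      {τ tag tag' : Ty B}
      (hv : ∀ a ∈ as, IsValue (.atom a)) (h : Step δ e e') :
      Step δ (.array ns (as ++ .box ιs e τ tag' :: as') tag)
        (.array ns (as ++ .box ιs e' τ tag' :: as') tag)
  | inFrame {ns : List ℕ} {es es' : List (Expr B V O)} {e e' : Expr B V O} {tag : Ty B}
      (hv : ∀ x ∈ es, IsValue (.expr x)) (h : Step δ e e') :
      Step δ (.frame ns (es ++ e :: es') tag) (.frame ns (es ++ e' :: es') tag)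
  | inFun {e e' : Expr B V O} {es : List (Expr B V O)} {tag : Ty B} (h : Step δ e e') :
      Step δ (.app e es tag) (.app e' es tag)
  | inArg {f e e' : Expr B V O} {es es' : List (Expr B V O)} {tag : Ty B}
      (hf : IsValue (.expr f)) (hv : ∀ x ∈ es, IsValue (.expr x)) (h : Step δ e e') :
      Step δ (.app f (es ++ e :: es') tag) (.app f (es ++ e' :: es') tag)
  | inTApp {e e' : Expr B V O} {τs : List (Ty B)} {tag : Ty B} (h : Step δ e e') :
      Step δ (.tapp e τs tag) (.tapp e' τs tag)
  | inIApp {e e' : Expr B V O} {ιs : List Idx} {tag : Ty B} (h : Step δ e e') :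
      Step δ (.iapp e ιs tag) (.iapp e' ιs tag)
  | inUnbox {n : ℕ} {e e' b : Expr B V O} {tag : Ty B} (h : Step δ e e') :
      Step δ (.unbox n e b tag) (.unbox n e' b tag)

end Reduction

end Remora

namespace Remora

/-! ### Indices -/

-- Apart from conversion along `TEqv`, typing follows the outermost form of a term. Conversion is an
-- equivalence relation that can be taken apart constructor by constructor (`TEqv.arr_inv`,
-- `TEqv.fn_inv` and so on). Hence a typing derivation inverts into the premises of a single rule
-- plus one equivalence (`HasType.array_inv`, `HasType.app_inv`, ...). Preservation is an induction
-- on the step. In the context rules the reduced subterm keeps its type, so the same typing rule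
-- applies again; the substance lies in the redexes.
--
-- For `β`, `tβ`, `iβ` and unboxing one needs that typing is stable under sort-, kind- and
-- type-respecting substitutions (`HasType.isubst`, `HasType.tsubst`, `HasType.subst`). These rest
-- on the usual commutation laws for parallel substitutions, in particular that instantiating a
-- binder commutes with an outer substitution. Index equations survive substitution for a semantic
-- reason: evaluating a substituted index is evaluating the original one under a composed
-- interpretation.
--
-- The redexes of function application share one difficulty. The derivation speaks of symbolic
-- frames and cell shapes and of a symbolic principal frame, whereas reduction works with concrete
-- dimension lists and with the types in the tag of the function array. `HasType.app_array_inv`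
-- reconciles the two. Each actual argument has shape frame followed by cell; its cell shape is a
-- known literal, so cancellation in the free monoid of lists makes its frame a known literal too.
-- The principal frame is one of the frames, hence also a literal. After that, lifting and mapping
-- are a matter of counting atoms: every atom of the contractum already occurs in the redex, and
-- `Split`, `Rep` and `Transpose` produce the right numbers. `δ` is covered by the soundness
-- assumption on the operators.
--
-- Well-formedness of the environment enters through regularity (`HasType.kinded`), which supplies
-- the kinds and sorts needed to type the frames that t-app, i-app and unbox reduce to, and as a
-- premise of operator soundness.

@[elab_as_elim]
theorem Idx.induction {P : Idx → Prop} (var : ∀ x, P (.var x)) (nat : ∀ n, P (.nat n))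
    (shp : ∀ ds, (∀ d ∈ ds, P d) → P (.shp ds)) (add : ∀ ds, (∀ d ∈ ds, P d) → P (.add ds))
    (append : ∀ ss, (∀ d ∈ ss, P d) → P (.append ss)) (ι : Idx) : P ι :=
  Idx.rec (motive_1 := P) (motive_2 := fun l => ∀ d ∈ l, P d) var nat shp add append
    (by simp) (fun _ _ h t => by simpa using ⟨h, t⟩) ι

/-- Indices contain no binders, so `Idx.shift` is itself a substitution and no separate layer of
index renamings is needed. -/
theorem Idx.subst_subst (s t : ℕ → Idx) (ι : Idx) :
    (ι.subst s).subst t = ι.subst fun x => (s x).subst t := by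
  induction ι using Idx.induction <;> simp_all [Idx.subst]

theorem Idx.subst_var (ι : Idx) : ι.subst Idx.var = ι := by
  induction ι using Idx.induction with
  | var x => simp [Idx.subst]
  | nat n => simp [Idx.subst]
  | shp ds ih => simpa [Idx.subst] using List.map_congr_left (g := id) ih
  | add ds ih => simpa [Idx.subst] using List.map_congr_left (g := id) ih
  | append ds ih => simpa [Idx.subst] using List.map_congr_left (g := id) ih

theorem instList_add_length {α : Type*} (var : ℕ → α) (ts : List α) (x : ℕ) :
    instList var ts (x + ts.length) = var x := by
  simp [instList]

theorem Idx.lift_add (n : ℕ) (s : ℕ → Idx) (x : ℕ) :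
    Idx.lift n s (x + n) = (s x).subst (Idx.shift n) := by
  simp [Idx.lift]

theorem Idx.lift_of_lt {n x : ℕ} (h : x < n) (s : ℕ → Idx) : Idx.lift n s x = .var x := by
  simp [Idx.lift, h]

theorem Idx.lift_var (n : ℕ) : Idx.lift n Idx.var = Idx.var := by
  funext x
  by_cases h : x < n
  · simp [Idx.lift, h]
  · simp [Idx.lift, h, Idx.subst, Idx.shift]; omega

theorem Idx.shift_subst_lift (n : ℕ) (s : ℕ → Idx) (ι : Idx) :
    (ι.subst (Idx.shift n)).subst (Idx.lift n s) = (ι.subst s).subst (Idx.shift n) := by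
  simp [Idx.subst_subst, Idx.shift, Idx.subst, Idx.lift_add]

theorem Idx.lift_subst_lift (n : ℕ) (s t : ℕ → Idx) (x : ℕ) :
    (Idx.lift n s x).subst (Idx.lift n t) = Idx.lift n (fun y => (s y).subst t) x := by
  by_cases h : x < n
  · simp [Idx.lift, h, Idx.subst]
  · simp only [Idx.lift, h, if_false]
    exact Idx.shift_subst_lift n t _

theorem Idx.shift_subst_inst (ιs : List Idx) (ι : Idx) :
    (ι.subst (Idx.shift ιs.length)).subst (instList Idx.var ιs) = ι := by
  simp [Idx.subst_subst, Idx.shift, Idx.subst, instList_add_length, Idx.subst_var]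

/-- On an instantiated variable both sides yield the substituted entry; on any other variable the
shift made by `Idx.lift` is cancelled by the instantiation. The i-app and box cases of the index
substitution lemma depend on this exchange. -/
theorem Idx.inst_subst (s : ℕ → Idx) (ιs : List Idx) (x : ℕ) :
    (instList Idx.var ιs x).subst s =
      (Idx.lift ιs.length s x).subst (instList Idx.var (ιs.map (Idx.subst s))) := by
  by_cases h : x < ιs.length
  · simp [instList, Idx.lift, h, Idx.subst]
  · obtain ⟨y, rfl⟩ := Nat.exists_eq_add_of_le' (not_lt.1 h)
    rw [instList_add_length, Idx.lift_add]
    simpa [Idx.subst] using (Idx.shift_subst_inst (ιs.map (Idx.subst s)) (s y)).symm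

-- Substitution and sorts.

/-- Substitutions that respect sorts. -/
def SortedSubst (Θ Θ' : List Srt) (s : ℕ → Idx) : Prop :=
  ∀ x γ, Θ[x]? = some γ → Sorted Θ' (s x) γ

theorem Sorted.subst {Θ Θ' : List Srt} {s : ℕ → Idx} (hs : SortedSubst Θ Θ' s) {ι : Idx} {γ : Srt}
    (h : Sorted Θ ι γ) : Sorted Θ' (ι.subst s) γ := by
  induction h with
  | var h => simpa [Idx.subst] using hs _ _ h
  | nat n => simpa [Idx.subst] using Sorted.nat n
  | shp _ ih => simpa [Idx.subst] using Sorted.shp (by simpa using ih)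
  | add _ ih => simpa [Idx.subst] using Sorted.add (by simpa using ih)
  | append _ ih => simpa [Idx.subst] using Sorted.append (by simpa using ih)

theorem SortedSubst.shift (γs Θ : List Srt) : SortedSubst Θ (γs ++ Θ) (Idx.shift γs.length) :=
  fun x γ h => .var (by simpa [List.getElem?_append_right] using h)

theorem SortedSubst.nil (Θ : List Srt) (s : ℕ → Idx) : SortedSubst [] Θ s :=
  fun x γ h => by simp at h

theorem SortedSubst.lift {Θ Θ' : List Srt} {s : ℕ → Idx} (hs : SortedSubst Θ Θ' s)
    (γs : List Srt) : SortedSubst (γs ++ Θ) (γs ++ Θ') (Idx.lift γs.length s) := by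
  intro x γ h
  by_cases hx : x < γs.length
  · rw [Idx.lift_of_lt hx]
    rw [List.getElem?_append_left hx] at h
    exact .var (by rw [List.getElem?_append_left hx, h])
  · obtain ⟨y, rfl⟩ := Nat.exists_eq_add_of_le' (not_lt.1 hx)
    rw [Idx.lift_add]
    exact (hs y γ (by simpa [List.getElem?_append_right] using h)).subst (.shift γs Θ')

theorem SortedSubst.inst {Θ γs : List Srt} {ιs : List Idx} (h : List.Forall₂ (Sorted Θ) ιs γs) :
    SortedSubst (γs ++ Θ) Θ (instList Idx.var ιs) := by
  intro x γ hx
  have hl := h.length_eq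
  by_cases hlt : x < γs.length
  · rw [List.getElem?_append_left hlt, List.getElem?_eq_getElem hlt] at hx
    have hlt' : x < ιs.length := hl ▸ hlt
    cases hx
    simpa [instList, hlt'] using h.get hlt' hlt
  · obtain ⟨y, rfl⟩ := Nat.exists_eq_add_of_le' (not_lt.1 hlt)
    rw [← hl, instList_add_length]
    exact .var (by simpa [List.getElem?_append_right] using hx)

-- Denotations of indices and index equivalence.

/-- The interpretation that reads variables as the entries of a substitution. -/
def Interp.comp (ρ : Interp) (s : ℕ → Idx) : Interp where
  dim x := (s x).evalDim ρ
  shape x := (s x).evalShape ρ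

theorem Idx.evalDim_subst (ρ : Interp) (s : ℕ → Idx) (ι : Idx) :
    (ι.subst s).evalDim ρ = ι.evalDim (ρ.comp s) := by
  induction ι using Idx.induction with
  | var x => simp [Idx.subst, Idx.evalDim, Interp.comp]
  | nat n => simp [Idx.subst, Idx.evalDim]
  | shp ds ih => simp [Idx.subst, Idx.evalDim]
  | add ds ih =>
    simp only [Idx.subst, Idx.evalDim, List.map_map]
    exact congrArg _ (List.map_congr_left ih)
  | append ds ih => simp [Idx.subst, Idx.evalDim]

theorem Idx.evalShape_subst (ρ : Interp) (s : ℕ → Idx) (ι : Idx) :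
    (ι.subst s).evalShape ρ = ι.evalShape (ρ.comp s) := by
  induction ι using Idx.induction with
  | var x => simp [Idx.subst, Idx.evalShape, Interp.comp]
  | nat n => simp [Idx.subst, Idx.evalShape]
  | shp ds ih => simp [Idx.subst, Idx.evalShape, Idx.evalDim_subst]
  | add ds ih => simp [Idx.subst, Idx.evalShape]
  | append ds ih =>
    simp only [Idx.subst, Idx.evalShape, List.map_map]
    exact congrArg _ (List.map_congr_left ih)

/-- An equation valid under every interpretation holds in particular under the composed
interpretations `ρ.comp s`, and these evaluate the substituted sides. -/
theorem IdxEqv.subst {Θ Θ' : List Srt} {s : ℕ → Idx} (hs : SortedSubst Θ Θ' s) {ι ι' : Idx}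
    (h : IdxEqv Θ ι ι') : IdxEqv Θ' (ι.subst s) (ι'.subst s) := by
  rcases h with ⟨h, h', e⟩ | ⟨h, h', e⟩
  · exact .inl ⟨h.subst hs, h'.subst hs, fun ρ => by simp [Idx.evalDim_subst, e]⟩
  · exact .inr ⟨h.subst hs, h'.subst hs, fun ρ => by simp [Idx.evalShape_subst, e]⟩

theorem IdxPrefix.subst {Θ Θ' : List Srt} {s : ℕ → Idx} (hs : SortedSubst Θ Θ' s) {ι ι' : Idx}
    (h : IdxPrefix Θ ι ι') : IdxPrefix Θ' (ι.subst s) (ι'.subst s) := by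
  obtain ⟨w, h⟩ := h
  exact ⟨w.subst s, by simpa [Idx.subst] using h.subst hs⟩

theorem IsMaxFrame.subst {Θ Θ' : List Srt} {s : ℕ → Idx} (hs : SortedSubst Θ Θ' s) {ι : Idx}
    {ιs : List Idx} (h : IsMaxFrame Θ ι ιs) :
    IsMaxFrame Θ' (ι.subst s) (ιs.map (Idx.subst s)) :=
  ⟨List.mem_map_of_mem h.1, by simpa using fun a ha => (h.2 a ha).subst hs⟩

/-- Uniqueness of sorts decides which disjunct of `IdxEqv` applies; it excludes the mixed cases in
transitivity and lets a known sort be carried across an equivalence. -/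
theorem Sorted.unique {Θ : List Srt} {ι : Idx} (h : Sorted Θ ι .dim) (h' : Sorted Θ ι .shape) :
    False := by
  cases h <;> cases h'
  simp_all

theorem IdxEqv.symm {Θ : List Srt} {ι ι' : Idx} (h : IdxEqv Θ ι ι') : IdxEqv Θ ι' ι := by
  rcases h with ⟨h, h', e⟩ | ⟨h, h', e⟩
  · exact .inl ⟨h', h, fun ρ => (e ρ).symm⟩
  · exact .inr ⟨h', h, fun ρ => (e ρ).symm⟩

theorem IdxEqv.trans {Θ : List Srt} {ι ι' ι'' : Idx} (h : IdxEqv Θ ι ι') (h' : IdxEqv Θ ι' ι'') :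
    IdxEqv Θ ι ι'' := by
  rcases h with ⟨a, b, e⟩ | ⟨a, b, e⟩ <;> rcases h' with ⟨a', b', e'⟩ | ⟨a', b', e'⟩
  · exact .inl ⟨a, b', fun ρ => (e ρ).trans (e' ρ)⟩
  · exact (b.unique a').elim
  · exact (a'.unique b).elim
  · exact .inr ⟨a, b', fun ρ => (e ρ).trans (e' ρ)⟩

theorem IdxEqv.sorted {Θ : List Srt} {ι ι' : Idx} {γ : Srt} (h : IdxEqv Θ ι ι')
    (hι : Sorted Θ ι γ) : Sorted Θ ι' γ := by
  rcases h with ⟨a, b, -⟩ | ⟨a, b, -⟩ <;> cases γ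
  · exact b
  · exact (a.unique hι).elim
  · exact (hι.unique a).elim
  · exact b

theorem sorted_shpLit (Θ : List Srt) (ns : List ℕ) : Sorted Θ (shpLit ns) .shape :=
  .shp (by simpa using fun n _ => Sorted.nat n)

@[simp] theorem evalShape_shpLit (ρ : Interp) (ns : List ℕ) : (shpLit ns).evalShape ρ = ns := by
  simp [shpLit, Idx.evalShape, Function.comp_def, Idx.evalDim]

@[simp] theorem shpLit_subst (s : ℕ → Idx) (ns : List ℕ) : (shpLit ns).subst s = shpLit ns := by
  simp [shpLit, Idx.subst]

theorem sorted_append {Θ : List Srt} {ι ι' : Idx} :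
    Sorted Θ (.append [ι, ι']) .shape ↔ Sorted Θ ι .shape ∧ Sorted Θ ι' .shape :=
  ⟨fun h => by cases h with | append h => simpa using h, fun h => .append (by simpa using h)⟩

@[simp] theorem evalShape_append (ρ : Interp) (ι ι' : Idx) :
    (Idx.append [ι, ι']).evalShape ρ = ι.evalShape ρ ++ ι'.evalShape ρ := by
  simp [Idx.evalShape]

theorem IdxEqv.evalShape {Θ : List Srt} {ι ι' : Idx} (h : IdxEqv Θ ι ι')
    (hι : Sorted Θ ι .shape) (ρ : Interp) : ι.evalShape ρ = ι'.evalShape ρ := by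
  rcases h with ⟨a, -, -⟩ | ⟨-, -, e⟩
  · exact (a.unique hι).elim
  · exact e ρ

/-! ### Types -/

section Types

variable {B : Type*}

-- The inputs of function types make `Ty` a nested inductive type, whose recursor has a second
-- motive for lists of types. Fixing that motive to be "every member satisfies `P`" gives the usable
-- induction principle.
@[elab_as_elim]
theorem Ty.induction {P : Ty B → Prop} (var : ∀ x, P (.var x)) (base : ∀ b, P (.base b))
    (arr : ∀ τ ι, P τ → P (.arr τ ι))
    (fn : ∀ ins out, (∀ τ ∈ ins, P τ) → P out → P (.fn ins out))
    (univ : ∀ ks τ, P τ → P (.univ ks τ)) (pi : ∀ γs τ, P τ → P (.pi γs τ))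
    (sigma : ∀ γs τ, P τ → P (.sigma γs τ)) (τ : Ty B) : P τ :=
  Ty.rec (motive_1 := P) (motive_2 := fun l => ∀ d ∈ l, P d) var base arr fn univ pi sigma
    (by simp) (fun _ _ h t => by simpa using ⟨h, t⟩) τ

theorem Ty.isubst_isubst (s t : ℕ → Idx) (τ : Ty B) :
    (τ.isubst s).isubst t = τ.isubst fun x => (s x).subst t := by
  induction τ using Ty.induction generalizing s t <;>
    simp_all [Ty.isubst, Idx.subst_subst, Idx.lift_subst_lift]

theorem Ty.isubst_var (τ : Ty B) : τ.isubst Idx.var = τ := by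
  induction τ using Ty.induction with
  | fn ins out ih ih' =>
    simpa [Ty.isubst, ih'] using List.map_congr_left (g := id) ih
  | _ => simp_all [Ty.isubst, Idx.subst_var, Idx.lift_var]

theorem Ty.shift_isubst_lift (n : ℕ) (s : ℕ → Idx) (τ : Ty B) :
    (τ.isubst (Idx.shift n)).isubst (Idx.lift n s) = (τ.isubst s).isubst (Idx.shift n) := by
  simp [Ty.isubst_isubst, Idx.shift, Idx.subst, Idx.lift_add]

theorem Ty.shift_iinst (ιs : List Idx) (τ : Ty B) :
    (τ.isubst (Idx.shift ιs.length)).iinst ιs = τ := by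
  simp [Ty.iinst, Ty.isubst_isubst, Idx.shift, Idx.subst, instList_add_length, Ty.isubst_var]

theorem Ty.iinst_isubst (s : ℕ → Idx) (ιs : List Idx) (τ : Ty B) :
    (τ.iinst ιs).isubst s = (τ.isubst (Idx.lift ιs.length s)).iinst (ιs.map (Idx.subst s)) := by
  simp [Ty.iinst, Ty.isubst_isubst, Idx.inst_subst]

theorem Ty.trename_isubst (r : ℕ → ℕ) (s : ℕ → Idx) (τ : Ty B) :
    (τ.trename r).isubst s = (τ.isubst s).trename r := by
  induction τ using Ty.induction generalizing r s <;> simp_all [Ty.isubst, Ty.trename]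

theorem Ty.lift_add (n : ℕ) (σ : ℕ → Ty B) (x : ℕ) :
    Ty.lift n σ (x + n) = (σ x).trename (· + n) := by
  simp [Ty.lift]

theorem Ty.lift_of_lt {n x : ℕ} (h : x < n) (σ : ℕ → Ty B) : Ty.lift n σ x = .var x := by
  simp [Ty.lift, h]

theorem Ty.lift_isubst (n : ℕ) (σ : ℕ → Ty B) (s : ℕ → Idx) :
    (fun x => (Ty.lift n σ x).isubst s) = Ty.lift n fun x => (σ x).isubst s := by
  funext x
  by_cases h : x < n <;> simp [Ty.lift, h, Ty.isubst, Ty.trename_isubst]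

/-- The two kinds of substitution commute once the index substitution has also been applied to the
replacing types. All mixed commutation laws used for typing derive from this one. -/
theorem Ty.tsubst_isubst (σ : ℕ → Ty B) (s : ℕ → Idx) (τ : Ty B) :
    (τ.tsubst σ).isubst s = (τ.isubst s).tsubst fun x => (σ x).isubst s := by
  induction τ using Ty.induction generalizing σ s <;>
    simp_all [Ty.isubst, Ty.tsubst, Ty.lift_isubst, Ty.shift_isubst_lift]

theorem Ty.shift_tsubst_isubst (n : ℕ) (s : ℕ → Idx) (τ : Ty B) :
    (τ.tsubst (Ty.shift n)).isubst s = (τ.isubst s).tsubst (Ty.shift n) := by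
  simp [Ty.tsubst_isubst, Ty.shift, Ty.isubst]
  rfl

/-- Types bind type variables, and `Ty.lift` shifts by renaming. The composition laws therefore have
to be built up: substitution after renaming, renaming after renaming, renaming after substitution,
and only then substitution after substitution. -/
theorem Ty.trename_tsubst (r : ℕ → ℕ) (σ : ℕ → Ty B) (τ : Ty B) :
    (τ.trename r).tsubst σ = τ.tsubst fun x => σ (r x) := by
  induction τ using Ty.induction generalizing r σ with
  | univ ks τ ih =>
    simp only [Ty.trename, Ty.tsubst, ih]
    congr 2
    funext x
    by_cases h : x < ks.length <;> simp [Ty.lift, h]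
  | _ => simp_all [Ty.trename, Ty.tsubst]

theorem Ty.trename_trename (r r' : ℕ → ℕ) (τ : Ty B) :
    (τ.trename r).trename r' = τ.trename fun x => r' (r x) := by
  induction τ using Ty.induction generalizing r r' with
  | univ ks τ ih =>
    simp only [Ty.trename, ih]
    congr 2
    funext x
    by_cases h : x < ks.length <;> simp [h]
  | _ => simp_all [Ty.trename]

theorem Ty.tsubst_trename (σ : ℕ → Ty B) (r : ℕ → ℕ) (τ : Ty B) :
    (τ.tsubst σ).trename r = τ.tsubst fun x => (σ x).trename r := by
  induction τ using Ty.induction generalizing r σ with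
  | univ ks τ ih =>
    simp only [Ty.trename, Ty.tsubst, ih]
    congr 2
    funext x
    by_cases h : x < ks.length <;> simp [Ty.lift, h, Ty.trename, Ty.trename_trename]
  | _ => simp_all [Ty.trename, Ty.tsubst, Ty.trename_isubst]

theorem Ty.lift_tsubst_lift (n : ℕ) (σ σ' : ℕ → Ty B) :
    (fun x => (Ty.lift n σ x).tsubst (Ty.lift n σ')) = Ty.lift n fun x => (σ x).tsubst σ' := by
  funext x
  by_cases h : x < n
  · simp [Ty.lift, h, Ty.tsubst]
  · obtain ⟨y, rfl⟩ := Nat.exists_eq_add_of_le' (not_lt.1 h)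
    simp [Ty.lift_add, Ty.trename_tsubst, Ty.tsubst_trename]

theorem Ty.tsubst_tsubst (σ σ' : ℕ → Ty B) (τ : Ty B) :
    (τ.tsubst σ).tsubst σ' = τ.tsubst fun x => (σ x).tsubst σ' := by
  induction τ using Ty.induction generalizing σ σ' <;>
    simp_all [Ty.tsubst, Ty.lift_tsubst_lift, Ty.tsubst_isubst]

theorem Ty.tsubst_var (τ : Ty B) : τ.tsubst Ty.var = τ := by
  induction τ using Ty.induction with
  | fn ins out ih ih' =>
    simpa [Ty.tsubst, ih'] using List.map_congr_left (g := id) ih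
  | univ ks τ ih =>
    have : Ty.lift ks.length (Ty.var (B := B)) = Ty.var := by
      funext x
      by_cases h : x < ks.length
      · simp [Ty.lift, h]
      · simp [Ty.lift, h, Ty.trename]; omega
    simp [Ty.tsubst, this, ih]
  | _ => simp_all [Ty.tsubst, Ty.isubst]

theorem Ty.tsubst_shift (n : ℕ) (τ : Ty B) : τ.tsubst (Ty.shift n) = τ.trename (· + n) := by
  have := Ty.trename_tsubst (· + n) Ty.var τ
  rw [Ty.tsubst_var] at this
  exact this.symm

theorem Ty.shift_tsubst_lift (n : ℕ) (σ : ℕ → Ty B) (τ : Ty B) :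
    (τ.tsubst (Ty.shift n)).tsubst (Ty.lift n σ) = (τ.tsubst σ).tsubst (Ty.shift n) := by
  rw [Ty.tsubst_tsubst, Ty.tsubst_tsubst]
  simp [Ty.shift, Ty.tsubst, Ty.lift_add, ← Ty.tsubst_shift]

theorem Ty.shift_tinst (τs : List (Ty B)) (τ : Ty B) :
    (τ.tsubst (Ty.shift τs.length)).tinst τs = τ := by
  rw [Ty.tinst, Ty.tsubst_tsubst]
  simp [Ty.shift, Ty.tsubst, instList_add_length, Ty.tsubst_var]

theorem Ty.tinst_isubst (s : ℕ → Idx) (τs : List (Ty B)) (τ : Ty B) :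
    (τ.tinst τs).isubst s = (τ.isubst s).tinst (τs.map (Ty.isubst s)) := by
  rw [Ty.tinst, Ty.tsubst_isubst, Ty.tinst]
  congr 1
  funext x
  by_cases h : x < τs.length <;> simp [instList, h, Ty.isubst]

theorem Ty.tinst_tsubst (σ : ℕ → Ty B) (τs : List (Ty B)) (τ : Ty B) :
    (τ.tinst τs).tsubst σ = (τ.tsubst (Ty.lift τs.length σ)).tinst (τs.map (Ty.tsubst σ)) := by
  rw [Ty.tinst, Ty.tsubst_tsubst, Ty.tinst, Ty.tsubst_tsubst]
  congr 1
  funext x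
  by_cases h : x < τs.length
  · simp [instList, h, Ty.lift, Ty.tsubst]
  · obtain ⟨y, rfl⟩ := Nat.exists_eq_add_of_le' (not_lt.1 h)
    rw [instList_add_length, Ty.lift_add, ← Ty.tsubst_shift]
    simpa [Ty.tsubst, Ty.tinst] using (Ty.shift_tinst (τs.map (Ty.tsubst σ)) (σ y)).symm

theorem Ty.shift_tsubst_shift (n : ℕ) (σ : ℕ → Ty B) (τ : Ty B) :
    (τ.isubst (Idx.shift n)).tsubst (fun x => (σ x).isubst (Idx.shift n)) =
      (τ.tsubst σ).isubst (Idx.shift n) :=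
  (Ty.tsubst_isubst σ _ τ).symm

theorem Ty.iinst_tsubst (σ : ℕ → Ty B) (ιs : List Idx) (τ : Ty B) :
    (τ.iinst ιs).tsubst σ =
      (τ.tsubst fun x => (σ x).isubst (Idx.shift ιs.length)).iinst ιs := by
  rw [Ty.iinst, Ty.iinst, Ty.tsubst_isubst]
  congr 1
  funext x
  exact (Ty.shift_iinst ιs (σ x)).symm

/-! ### Kinding -/

/-- Substitutions that respect kinds. -/
def KindedSubst (Θ : List Srt) (Δ Δ' : List Kind) (σ : ℕ → Ty B) : Prop :=
  ∀ x k, Δ[x]? = some k → Kinded Θ Δ' (σ x) k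

theorem Kinded.isubst {Θ Θ' : List Srt} {Δ : List Kind} {τ : Ty B} {k : Kind} {s : ℕ → Idx}
    (h : Kinded Θ Δ τ k) (hs : SortedSubst Θ Θ' s) : Kinded Θ' Δ (τ.isubst s) k := by
  induction h generalizing Θ' s with
  | var h => simpa [Ty.isubst] using Kinded.var h
  | base b => simpa [Ty.isubst] using Kinded.base b
  | arr _ hι ih => simpa [Ty.isubst] using Kinded.arr (ih hs) (hι.subst hs)
  | fn _ _ ih ih' =>
    simpa [Ty.isubst] using Kinded.fn (by simpa using fun τ hτ => ih τ hτ hs) (ih' hs)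
  | univ _ ih => simpa [Ty.isubst] using Kinded.univ (ih hs)
  | pi _ ih => simpa [Ty.isubst] using Kinded.pi (ih (hs.lift _))
  | sigma _ ih => simpa [Ty.isubst] using Kinded.sigma (ih (hs.lift _))

theorem Kinded.trename {Θ : List Srt} {Δ Δ' : List Kind} {τ : Ty B} {k : Kind} {r : ℕ → ℕ}
    (h : Kinded Θ Δ τ k) (hr : ∀ x k, Δ[x]? = some k → Δ'[r x]? = some k) :
    Kinded Θ Δ' (τ.trename r) k := by
  induction h generalizing Δ' r with
  | var h => simpa [Ty.trename] using Kinded.var (hr _ _ h)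
  | base b => simpa [Ty.trename] using Kinded.base b
  | arr _ hι ih => simpa [Ty.trename] using Kinded.arr (ih hr) hι
  | fn _ _ ih ih' =>
    simpa [Ty.trename] using Kinded.fn (by simpa using fun τ hτ => ih τ hτ hr) (ih' hr)
  | @univ Θ Δ ks τ _ ih =>
    rw [Ty.trename]
    refine Kinded.univ (ih ?_)
    intro x k h
    by_cases hx : x < ks.length
    · simpa [hx, List.getElem?_append_left] using h
    · obtain ⟨y, rfl⟩ := Nat.exists_eq_add_of_le' (not_lt.1 hx)
      simpa [List.getElem?_append_right] using hr y k (by simpa [List.getElem?_append_right] using h)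
  | pi _ ih => simpa [Ty.trename] using Kinded.pi (ih hr)
  | sigma _ ih => simpa [Ty.trename] using Kinded.sigma (ih hr)

theorem KindedSubst.lift {Θ : List Srt} {Δ Δ' : List Kind} {σ : ℕ → Ty B}
    (hσ : KindedSubst Θ Δ Δ' σ) (ks : List Kind) :
    KindedSubst Θ (ks ++ Δ) (ks ++ Δ') (Ty.lift ks.length σ) := by
  intro x k h
  by_cases hx : x < ks.length
  · rw [Ty.lift_of_lt hx]
    rw [List.getElem?_append_left hx] at h
    exact .var (by rw [List.getElem?_append_left hx, h])
  · obtain ⟨y, rfl⟩ := Nat.exists_eq_add_of_le' (not_lt.1 hx)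
    rw [Ty.lift_add]
    exact (hσ y k (by simpa [List.getElem?_append_right] using h)).trename
      (by simp [List.getElem?_append_right])

theorem KindedSubst.ishift {Θ : List Srt} {Δ Δ' : List Kind} {σ : ℕ → Ty B}
    (hσ : KindedSubst Θ Δ Δ' σ) (γs : List Srt) :
    KindedSubst (γs ++ Θ) Δ Δ' fun x => (σ x).isubst (Idx.shift γs.length) :=
  fun x k h => (hσ x k h).isubst (.shift γs Θ)

theorem KindedSubst.shift (Θ : List Srt) (ks Δ : List Kind) :
    KindedSubst Θ Δ (ks ++ Δ) (Ty.shift (B := B) ks.length) :=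
  fun x k h => .var (by simpa [List.getElem?_append_right] using h)

theorem KindedSubst.inst {Θ : List Srt} {Δ ks : List Kind} {τs : List (Ty B)}
    (h : List.Forall₂ (Kinded Θ Δ) τs ks) :
    KindedSubst Θ (ks ++ Δ) Δ (instList Ty.var τs) := by
  intro x k hx
  have hl := h.length_eq
  by_cases hlt : x < ks.length
  · rw [List.getElem?_append_left hlt, List.getElem?_eq_getElem hlt] at hx
    have hlt' : x < τs.length := hl ▸ hlt
    cases hx
    simpa [instList, hlt'] using h.get hlt' hlt
  · obtain ⟨y, rfl⟩ := Nat.exists_eq_add_of_le' (not_lt.1 hlt)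
    rw [← hl, instList_add_length]
    exact .var (by simpa [List.getElem?_append_right] using hx)

theorem Kinded.tsubst {Θ : List Srt} {Δ Δ' : List Kind} {τ : Ty B} {k : Kind} {σ : ℕ → Ty B}
    (h : Kinded Θ Δ τ k) (hσ : KindedSubst Θ Δ Δ' σ) : Kinded Θ Δ' (τ.tsubst σ) k := by
  induction h generalizing Δ' σ with
  | var h => simpa [Ty.tsubst] using hσ _ _ h
  | base b => simpa [Ty.tsubst] using Kinded.base b
  | arr _ hι ih => simpa [Ty.tsubst] using Kinded.arr (ih hσ) hι
  | fn _ _ ih ih' =>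
    simpa [Ty.tsubst] using Kinded.fn (by simpa using fun τ hτ => ih τ hτ hσ) (ih' hσ)
  | univ _ ih => simpa [Ty.tsubst] using Kinded.univ (ih (hσ.lift _))
  | pi _ ih => simpa [Ty.tsubst] using Kinded.pi (ih (hσ.ishift _))
  | sigma _ ih => simpa [Ty.tsubst] using Kinded.sigma (ih (hσ.ishift _))

theorem Sorted.subst_eq_self {Θ : List Srt} {s : ℕ → Idx} {ι : Idx} {γ : Srt}
    (h : Sorted Θ ι γ) (hs : ∀ x < Θ.length, s x = .var x) : ι.subst s = ι := by
  induction h with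
  | var h => simpa [Idx.subst] using hs _ (List.getElem?_eq_some_iff.1 h).1
  | nat n => simp [Idx.subst]
  | shp _ ih => simpa [Idx.subst] using List.map_congr_left (g := id) ih
  | add _ ih => simpa [Idx.subst] using List.map_congr_left (g := id) ih
  | append _ ih => simpa [Idx.subst] using List.map_congr_left (g := id) ih

theorem Idx.lift_eq_var {n m : ℕ} {s : ℕ → Idx} (hs : ∀ x < m, s x = .var x) :
    ∀ x < n + m, Idx.lift n s x = .var x := by
  intro x hx
  by_cases h : x < n
  · exact Idx.lift_of_lt h s
  · obtain ⟨y, rfl⟩ := Nat.exists_eq_add_of_le' (not_lt.1 h)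
    rw [Idx.lift_add, hs y (by omega)]
    simp [Idx.subst, Idx.shift]

/-- Used with empty `Θ`: operator types are closed, and the substitution lemmas need them literally
unchanged. -/
theorem Kinded.isubst_eq_self {Θ : List Srt} {Δ : List Kind} {τ : Ty B} {k : Kind} {s : ℕ → Idx}
    (h : Kinded Θ Δ τ k) (hs : ∀ x < Θ.length, s x = .var x) : τ.isubst s = τ := by
  induction h generalizing s with
  | var h => simp [Ty.isubst]
  | base b => simp [Ty.isubst]
  | arr _ hι ih => simp [Ty.isubst, ih hs, hι.subst_eq_self hs]
  | fn _ _ ih ih' =>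
    simpa [Ty.isubst, ih' hs] using List.map_congr_left (g := id) fun τ hτ => ih τ hτ hs
  | univ _ ih => simp [Ty.isubst, ih hs]
  | pi _ ih => simp [Ty.isubst, ih (by simpa using Idx.lift_eq_var hs)]
  | sigma _ ih => simp [Ty.isubst, ih (by simpa using Idx.lift_eq_var hs)]

theorem Kinded.tsubst_eq_self {Θ : List Srt} {Δ : List Kind} {τ : Ty B} {k : Kind} {σ : ℕ → Ty B}
    (h : Kinded Θ Δ τ k) (hσ : ∀ x < Δ.length, σ x = .var x) : τ.tsubst σ = τ := by
  induction h generalizing σ with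
  | var h => simpa [Ty.tsubst] using hσ _ (List.getElem?_eq_some_iff.1 h).1
  | base b => simp [Ty.tsubst]
  | arr _ hι ih => simp [Ty.tsubst, ih hσ]
  | fn _ _ ih ih' =>
    simpa [Ty.tsubst, ih' hσ] using List.map_congr_left (g := id) fun τ hτ => ih τ hτ hσ
  | @univ Θ Δ ks τ _ ih =>
    rw [Ty.tsubst, ih]
    intro x hx
    by_cases h : x < ks.length
    · exact Ty.lift_of_lt h σ
    · obtain ⟨y, rfl⟩ := Nat.exists_eq_add_of_le' (not_lt.1 h)
      rw [List.length_append] at hx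
      rw [Ty.lift_add, hσ y (by omega)]
      simp [Ty.trename]
  | pi _ ih =>
    rw [Ty.tsubst, ih]
    intro x hx
    simp [hσ x hx, Ty.isubst]
  | sigma _ ih =>
    rw [Ty.tsubst, ih]
    intro x hx
    simp [hσ x hx, Ty.isubst]

/-- Weakening from empty environments is substitution by the identity, which vacuously respects the
empty environments. -/
theorem Kinded.of_closed {τ : Ty B} {k : Kind} (h : Kinded [] [] τ k) (Θ : List Srt)
    (Δ : List Kind) : Kinded Θ Δ τ k := by
  have h1 := h.isubst (SortedSubst.nil Θ Idx.var)
  rw [Ty.isubst_var] at h1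
  have h2 := h1.tsubst (Δ' := Δ) (σ := Ty.var) (fun x k h => by simp at h)
  rwa [Ty.tsubst_var] at h2

theorem kinded_arr {Θ : List Srt} {Δ : List Kind} {τ : Ty B} {ι : Idx} :
    Kinded Θ Δ (.arr τ ι) .array ↔ Kinded Θ Δ τ .atom ∧ Sorted Θ ι .shape :=
  ⟨fun h => by cases h with | arr h h' => exact ⟨h, h'⟩, fun h => .arr h.1 h.2⟩

/-! ### Type equivalence -/

theorem TEqv.symm {Θ : List Srt} {τ τ' : Ty B} (h : TEqv Θ τ τ') : TEqv Θ τ' τ := by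
  induction h with
  | refl τ => exact .refl τ
  | arr _ hι ih => exact .arr ih hι.symm
  | fn hl _ _ ih ih' => exact .fn hl.symm (fun i τ τ' h h' => ih i τ' τ h' h) ih'
  | univ _ ih => exact .univ ih
  | pi _ ih => exact .pi ih
  | sigma _ ih => exact .sigma ih

theorem TEqv.trans {Θ : List Srt} {τ τ' τ'' : Ty B} (h : TEqv Θ τ τ') (h' : TEqv Θ τ' τ'') :
    TEqv Θ τ τ'' := by
  induction h generalizing τ'' with
  | refl τ => exact h'
  | arr h hι ih =>
    cases h' with
    | refl => exact .arr h hι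
    | arr h' hι' => exact .arr (ih h') (hι.trans hι')
  | @fn Θ ins ins' out out' hl hi ho ih ih' =>
    cases h' with
    | refl => exact .fn hl hi ho
    | fn hl' hi' ho' =>
      refine .fn (hl.trans hl') (fun i τ τ' h h' => ?_) (ih' ho')
      -- The rule for function types compares entries position by position, so transitivity needs
      -- the middle entry to exist; the equal lengths provide it.
      have hlt : i < ins'.length := hl ▸ (List.getElem?_eq_some_iff.1 h).1
      exact ih i τ _ h (List.getElem?_eq_getElem hlt) (hi' i _ _ (List.getElem?_eq_getElem hlt) h')
  | univ h ih =>
    cases h' with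
    | refl => exact .univ h
    | univ h' => exact .univ (ih h')
  | pi h ih =>
    cases h' with
    | refl => exact .pi h
    | pi h' => exact .pi (ih h')
  | sigma h ih =>
    cases h' with
    | refl => exact .sigma h
    | sigma h' => exact .sigma (ih h')

theorem TEqv.isubst {Θ Θ' : List Srt} {τ τ' : Ty B} {s : ℕ → Idx} (h : TEqv Θ τ τ')
    (hs : SortedSubst Θ Θ' s) : TEqv Θ' (τ.isubst s) (τ'.isubst s) := by
  induction h generalizing Θ' s with
  | refl τ => exact .refl _
  | arr _ hι ih => simpa [Ty.isubst] using TEqv.arr (ih hs) (hι.subst hs)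
  | fn hl _ _ ih ih' =>
    simp only [Ty.isubst]
    refine .fn (by simpa using hl) (fun i τ τ' h h' => ?_) (ih' hs)
    simp only [List.getElem?_map, Option.map_eq_some_iff] at h h'
    obtain ⟨τ, h, rfl⟩ := h
    obtain ⟨τ', h', rfl⟩ := h'
    exact ih i τ τ' h h' hs
  | univ _ ih => simpa [Ty.isubst] using TEqv.univ (ih hs)
  | pi _ ih => simpa [Ty.isubst] using TEqv.pi (ih (hs.lift _))
  | sigma _ ih => simpa [Ty.isubst] using TEqv.sigma (ih (hs.lift _))

/-- No condition on `σ` is needed, since the two sides differ only in indices of the original types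
and type substitution leaves these alone. -/
theorem TEqv.tsubst {Θ : List Srt} {τ τ' : Ty B} (h : TEqv Θ τ τ') (σ : ℕ → Ty B) :
    TEqv Θ (τ.tsubst σ) (τ'.tsubst σ) := by
  induction h generalizing σ with
  | refl τ => exact .refl _
  | arr _ hι ih => simpa [Ty.tsubst] using TEqv.arr (ih σ) hι
  | fn hl _ _ ih ih' =>
    simp only [Ty.tsubst]
    refine .fn (by simpa using hl) (fun i τ τ' h h' => ?_) (ih' σ)
    simp only [List.getElem?_map, Option.map_eq_some_iff] at h h'
    obtain ⟨τ, h, rfl⟩ := h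
    obtain ⟨τ', h', rfl⟩ := h'
    exact ih i τ τ' h h' σ
  | univ _ ih => simpa [Ty.tsubst] using TEqv.univ (ih _)
  | pi _ ih => simpa [Ty.tsubst] using TEqv.pi (ih _)
  | sigma _ ih => simpa [Ty.tsubst] using TEqv.sigma (ih _)

theorem TEqv.kinded {Θ : List Srt} {Δ : List Kind} {τ τ' : Ty B} {k : Kind} (h : TEqv Θ τ τ')
    (hk : Kinded Θ Δ τ k) : Kinded Θ Δ τ' k := by
  induction h generalizing Δ k with
  | refl τ => exact hk
  | arr _ hι ih => cases hk with | arr h h' => exact .arr (ih h) (hι.sorted h')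
  | @fn Θ ins ins' out out' hl hi ho ih ih' =>
    cases hk with
    | fn h h' =>
      refine .fn (fun τ hτ => ?_) (ih' h')
      obtain ⟨i, hi, rfl⟩ := List.mem_iff_getElem.1 hτ
      exact ih i (ins[i]) _ (List.getElem?_eq_getElem (by omega)) (List.getElem?_eq_getElem hi)
        (h _ (List.getElem_mem _))
  | univ _ ih => cases hk with | univ h => exact .univ (ih h)
  | pi _ ih => cases hk with | pi h => exact .pi (ih h)
  | sigma _ ih => cases hk with | sigma h => exact .sigma (ih h)

/-- The sort hypothesis is there for reflexivity: `TEqv` relates even an ill-sorted type to itself,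
while `IdxEqv` requires both indices to be sorted. -/
theorem TEqv.arr_inv {Θ : List Srt} {τ τ' : Ty B} {ι ι' : Idx}
    (h : TEqv Θ (.arr τ ι) (.arr τ' ι')) (hs : Sorted Θ ι .shape) :
    TEqv Θ τ τ' ∧ IdxEqv Θ ι ι' := by
  cases h with
  | refl => exact ⟨.refl _, .inr ⟨hs, hs, fun _ => rfl⟩⟩
  | arr h h' => exact ⟨h, h'⟩

theorem TEqv.fn_inv {Θ : List Srt} {ins ins' : List (Ty B)} {out out' : Ty B}
    (h : TEqv Θ (.fn ins out) (.fn ins' out')) :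
    List.Forall₂ (TEqv Θ) ins ins' ∧ TEqv Θ out out' := by
  cases h with
  | refl => exact ⟨List.forall₂_same.2 fun _ _ => .refl _, .refl _⟩
  | fn hl hi ho =>
    refine ⟨List.forall₂_iff_get.2 ⟨hl, fun i h h' => hi i _ _ ?_ ?_⟩, ho⟩ <;> simp

theorem TEqv.univ_inv {Θ : List Srt} {ks ks' : List Kind} {τ τ' : Ty B}
    (h : TEqv Θ (.univ ks τ) (.univ ks' τ')) : ks = ks' ∧ TEqv Θ τ τ' := by
  cases h with
  | refl => exact ⟨rfl, .refl _⟩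
  | univ h => exact ⟨rfl, h⟩

theorem TEqv.pi_inv {Θ γs γs' : List Srt} {τ τ' : Ty B}
    (h : TEqv Θ (.pi γs τ) (.pi γs' τ')) : γs = γs' ∧ TEqv (γs' ++ Θ) τ τ' := by
  cases h with
  | refl => exact ⟨rfl, .refl _⟩
  | pi h => exact ⟨rfl, h⟩

theorem TEqv.sigma_inv {Θ γs γs' : List Srt} {τ τ' : Ty B}
    (h : TEqv Θ (.sigma γs τ) (.sigma γs' τ')) : γs = γs' ∧ TEqv (γs' ++ Θ) τ τ' := by
  cases h with
  | refl => exact ⟨rfl, .refl _⟩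
  | sigma h => exact ⟨rfl, h⟩

end Types

section Terms

variable {B V O : Type*}

/-! ### Substitution in terms -/

/-- Parallel substitution of indices in a term. -/
def Term.isubst (s : ℕ → Idx) : Term B V O → Term B V O
  | .expr e => .expr (e.isubst s)
  | .atom a => .atom (a.isubst s)

/-- Parallel substitution of types in a term. -/
def Term.tsubst (σ : ℕ → Ty B) : Term B V O → Term B V O
  | .expr e => .expr (e.tsubst σ)
  | .atom a => .atom (a.tsubst σ)

/-- Renaming of term variables in a term. -/
def Term.rename (r : ℕ → ℕ) : Term B V O → Term B V O
  | .expr e => .expr (e.rename r)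
  | .atom a => .atom (a.rename r)

/-- Parallel substitution of expressions for term variables in a term. -/
def Term.subst (s : TermSubst B V O) : Term B V O → Term B V O
  | .expr e => .expr (e.subst s)
  | .atom a => .atom (a.subst s)

/-- The typing rules for type and index abstractions demand value bodies, so each kind of
substitution must preserve values. It does because being a value depends only on the term formers
outside the bodies of `λ`, and no variable occurs there as an expression. -/
theorem IsValue.isubst {t : Term B V O} (h : IsValue t) (s : ℕ → Idx) : IsValue (t.isubst s) := by
  induction h generalizing s with
  | array _ ih =>
    simp only [Term.isubst, Expr.isubst] at ih ⊢
    exact .array (by simpa using fun a ha => ih a ha s)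
  | base => simp only [Term.isubst, Atom.isubst]; exact .base _ _
  | op => simp only [Term.isubst, Atom.isubst]; exact .op _ _
  | lam => simp only [Term.isubst, Atom.isubst]; exact .lam _ _ _
  | tlam _ ih => simp only [Term.isubst, Atom.isubst] at ih ⊢; exact .tlam (ih _)
  | ilam _ ih => simp only [Term.isubst, Atom.isubst] at ih ⊢; exact .ilam (ih _)
  | box _ ih => simp only [Term.isubst, Atom.isubst] at ih ⊢; exact .box (ih _)

theorem IsValue.tsubst {t : Term B V O} (h : IsValue t) (σ : ℕ → Ty B) :
    IsValue (t.tsubst σ) := by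
  induction h generalizing σ with
  | array _ ih =>
    simp only [Term.tsubst, Expr.tsubst] at ih ⊢
    exact .array (by simpa using fun a ha => ih a ha σ)
  | base => simp only [Term.tsubst, Atom.tsubst]; exact .base _ _
  | op => simp only [Term.tsubst, Atom.tsubst]; exact .op _ _
  | lam => simp only [Term.tsubst, Atom.tsubst]; exact .lam _ _ _
  | tlam _ ih => simp only [Term.tsubst, Atom.tsubst] at ih ⊢; exact .tlam (ih _)
  | ilam _ ih => simp only [Term.tsubst, Atom.tsubst] at ih ⊢; exact .ilam (ih _)
  | box _ ih => simp only [Term.tsubst, Atom.tsubst] at ih ⊢; exact .box (ih _)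

theorem IsValue.rename {t : Term B V O} (h : IsValue t) (r : ℕ → ℕ) : IsValue (t.rename r) := by
  induction h generalizing r with
  | array _ ih =>
    simp only [Term.rename, Expr.rename] at ih ⊢
    exact .array (by simpa using fun a ha => ih a ha r)
  | base => simp only [Term.rename, Atom.rename]; exact .base _ _
  | op => simp only [Term.rename, Atom.rename]; exact .op _ _
  | lam => simp only [Term.rename, Atom.rename]; exact .lam _ _ _
  | tlam _ ih => simp only [Term.rename, Atom.rename] at ih ⊢; exact .tlam (ih _)
  | ilam _ ih => simp only [Term.rename, Atom.rename] at ih ⊢; exact .ilam (ih _)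
  | box _ ih => simp only [Term.rename, Atom.rename] at ih ⊢; exact .box (ih _)

theorem IsValue.subst {t : Term B V O} (h : IsValue t) (s : TermSubst B V O) :
    IsValue (t.subst s) := by
  induction h generalizing s with
  | array _ ih =>
    simp only [Term.subst, Expr.subst] at ih ⊢
    exact .array (by simpa using fun a ha => ih a ha s)
  | base => simp only [Term.subst, Atom.subst]; exact .base _ _
  | op => simp only [Term.subst, Atom.subst]; exact .op _ _
  | lam => simp only [Term.subst, Atom.subst]; exact .lam _ _ _
  | tlam _ ih => simp only [Term.subst, Atom.subst] at ih ⊢; exact .tlam (ih _)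
  | ilam _ ih => simp only [Term.subst, Atom.subst] at ih ⊢; exact .ilam (ih _)
  | box _ ih => simp only [Term.subst, Atom.subst] at ih ⊢; exact .box (ih _)

/-- Parallel substitution of indices in the data of an argument position. -/
def ArgTy.isubst (s : ℕ → Idx) (p : ArgTy B) : ArgTy B :=
  ⟨p.elt.isubst s, p.cell.subst s, p.frame.subst s⟩

/-- Parallel substitution of types in the data of an argument position. -/
def ArgTy.tsubst (σ : ℕ → Ty B) (p : ArgTy B) : ArgTy B :=
  ⟨p.elt.tsubst σ, p.cell, p.frame⟩

theorem ArgTy.map_param_isubst (s : ℕ → Idx) (ps : List (ArgTy B)) :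
    (ps.map (ArgTy.isubst s)).map ArgTy.param = (ps.map ArgTy.param).map (Ty.isubst s) := by
  simp [ArgTy.param, ArgTy.isubst, Ty.isubst]

theorem ArgTy.map_param_tsubst (σ : ℕ → Ty B) (ps : List (ArgTy B)) :
    (ps.map (ArgTy.tsubst σ)).map ArgTy.param = (ps.map ArgTy.param).map (Ty.tsubst σ) := by
  simp [ArgTy.param, ArgTy.tsubst, Ty.tsubst]

theorem forall₂_sorted_subst {Θ Θ' : List Srt} {s : ℕ → Idx} (hs : SortedSubst Θ Θ' s)
    {ιs : List Idx} {γs : List Srt} (h : List.Forall₂ (Sorted Θ) ιs γs) :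
    List.Forall₂ (Sorted Θ') (ιs.map (Idx.subst s)) γs :=
  List.forall₂_map_left_iff.2 (h.imp fun _ _ h => h.subst hs)

theorem forall₂_kinded_isubst {Θ Θ' : List Srt} {Δ : List Kind} {s : ℕ → Idx}
    (hs : SortedSubst Θ Θ' s) {τs : List (Ty B)} {ks : List Kind}
    (h : List.Forall₂ (Kinded Θ Δ) τs ks) :
    List.Forall₂ (Kinded Θ' Δ) (τs.map (Ty.isubst s)) ks :=
  List.forall₂_map_left_iff.2 (h.imp fun _ _ h => h.isubst hs)

theorem forall₂_kinded_tsubst {Θ : List Srt} {Δ Δ' : List Kind} {σ : ℕ → Ty B}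
    (hσ : KindedSubst Θ Δ Δ' σ) {τs : List (Ty B)} {ks : List Kind}
    (h : List.Forall₂ (Kinded Θ Δ) τs ks) :
    List.Forall₂ (Kinded Θ Δ') (τs.map (Ty.tsubst σ)) ks :=
  List.forall₂_map_left_iff.2 (h.imp fun _ _ h => h.tsubst hσ)

-- Typing under index and type substitution.

variable {S : Signature B V O}

theorem HasType.isubst {Θ Θ' : List Srt} {Δ : List Kind} {Γ : List (Ty B)} {t : Term B V O}
    {τ : Ty B} {s : ℕ → Idx} (h : HasType S Θ Δ Γ t τ) (hs : SortedSubst Θ Θ' s) :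
    HasType S Θ' Δ (Γ.map (Ty.isubst s)) (t.isubst s) (τ.isubst s) := by
  induction h generalizing Θ' s with
  | eqv _ he ih => exact .eqv (ih hs) (he.isubst hs)
  | var h htag =>
    simp only [Term.isubst, Expr.isubst]
    exact .var (by simp [h]) (htag.isubst hs)
  | array _ hk hl htag ih =>
    have htag := htag.isubst hs
    simp only [Term.isubst, Expr.isubst, Ty.isubst, shpLit_subst] at htag ih ⊢
    exact .array (by simpa using fun a ha => ih a ha hs) (hk.isubst hs) (by simpa using hl) htag
  | frame _ hk hl htag ih =>
    have htag := htag.isubst hs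
    have hk := hk.isubst hs
    simp only [Term.isubst, Expr.isubst, Ty.isubst, Idx.subst, List.map_cons, List.map_nil,
      shpLit_subst] at htag ih hk ⊢
    exact .frame (by simpa using fun a ha => ih a ha hs) hk (by simpa using hl) htag
  | @app Θ Δ Γ f es ps τo tag ιo ιf ιp _ hl _ hp htag ihf ih =>
    have htag := htag.isubst hs
    have hp := hp.subst hs
    have ihf := ihf hs
    simp only [Term.isubst, Expr.isubst, Ty.isubst, Idx.subst, List.map_cons, List.map_nil,
      List.map_map] at htag ih ihf hp ⊢
    refine .app (ps := ps.map (ArgTy.isubst s))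
      (by rw [ArgTy.map_param_isubst, List.map_map]; exact ihf)
      (by simpa using hl) ?_ (by rw [List.map_map]; exact hp) htag
    intro i e p he hp
    simp only [List.getElem?_map, Option.map_eq_some_iff] at he hp
    obtain ⟨e, he, rfl⟩ := he
    obtain ⟨p, hp, rfl⟩ := hp
    simpa [ArgTy.actual, ArgTy.isubst, Ty.isubst, Idx.subst] using ih i e p he hp hs
  | tapp _ ha htag ih =>
    have htag := htag.isubst hs
    have ih := ih hs
    simp only [Term.isubst, Expr.isubst, Ty.isubst, Idx.subst, List.map_cons, List.map_nil,
      Ty.tinst_isubst] at htag ih ⊢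
    exact .tapp ih (forall₂_kinded_isubst hs ha) htag
  | iapp _ ha htag ih =>
    have htag := htag.isubst hs
    have ih := ih hs
    have hl := ha.length_eq
    simp only [Term.isubst, Expr.isubst, Ty.isubst, Idx.subst, List.map_cons, List.map_nil,
      Ty.iinst_isubst, Idx.subst_subst, Idx.inst_subst, hl] at htag ih ⊢
    -- The previous step fused instantiation and `s` into one substitution in order to apply
    -- `Idx.inst_subst` pointwise; splitting it again recovers the shape that the i-app rule
    -- produces.
    simp only [← Idx.subst_subst] at htag ⊢
    exact .iapp ih (forall₂_sorted_subst hs ha) htag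
  | unbox _ hn _ hk htag ih ihb =>
    subst hn
    have htag := htag.isubst hs
    have hk := hk.isubst hs
    have ih := ih hs
    have ihb := ihb (hs.lift _)
    rw [Ty.shift_isubst_lift] at ihb
    simp only [Term.isubst, Expr.isubst, Ty.isubst, Idx.subst, List.map_cons, List.map_nil,
      List.map_map, Function.comp_def, Ty.shift_isubst_lift] at htag hk ih ihb ⊢
    refine .unbox ih rfl ?_ hk htag
    simpa [Ty.isubst, Function.comp_def] using ihb
  | base htag =>
    have htag := htag.isubst hs
    simp only [Term.isubst, Atom.isubst, Ty.isubst] at htag ⊢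
    exact .base htag
  | @op Θ Δ Γ o tag htag =>
    have htag := htag.isubst hs
    -- The operator rule ascribes exactly `S.opTy o`, so the substitution has to disappear from a
    -- closed type.
    rw [(S.opTy_kinded o).isubst_eq_self (by simp)] at htag ⊢
    simp only [Term.isubst, Atom.isubst]
    exact .op htag
  | lam _ hk htag ih =>
    have htag := htag.isubst hs
    have ih := ih hs
    simp only [Term.isubst, Atom.isubst, Ty.isubst, List.map_append] at htag ih ⊢
    refine .lam ih ?_ htag
    simpa using fun τ hτ => (hk τ hτ).isubst hs
  | tlam hv _ htag ih =>
    have htag := htag.isubst hs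
    have ih := ih hs
    have hv := hv.isubst s
    simp only [Term.isubst, Atom.isubst, Ty.isubst, List.map_map, Function.comp_def,
      Ty.shift_tsubst_isubst] at htag ih hv ⊢
    refine .tlam hv ?_ htag
    simpa [Function.comp_def] using ih
  | @ilam Θ γs Δ Γ e τ tag hv _ htag ih =>
    have htag := htag.isubst hs
    have ih := ih (hs.lift _)
    have hv := hv.isubst (Idx.lift γs.length s)
    simp only [Term.isubst, Atom.isubst, Ty.isubst, List.map_map, Function.comp_def,
      Ty.shift_isubst_lift] at htag ih hv ⊢
    refine .ilam hv ?_ htag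
    simpa [Function.comp_def] using ih
  | box hι hk _ htag ih =>
    have htag := htag.isubst hs
    have hk := hk.isubst hs
    have ih := ih hs
    simp only [Term.isubst, Atom.isubst, Ty.isubst, Ty.iinst_isubst, hι.length_eq]
      at htag hk ih ⊢
    exact .box (forall₂_sorted_subst hs hι) hk ih htag

theorem HasType.tsubst {Θ : List Srt} {Δ Δ' : List Kind} {Γ : List (Ty B)} {t : Term B V O}
    {τ : Ty B} {σ : ℕ → Ty B} (h : HasType S Θ Δ Γ t τ) (hσ : KindedSubst Θ Δ Δ' σ) :
    HasType S Θ Δ' (Γ.map (Ty.tsubst σ)) (t.tsubst σ) (τ.tsubst σ) := by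
  induction h generalizing Δ' σ with
  | eqv _ he ih => exact .eqv (ih hσ) (he.tsubst σ)
  | var h htag =>
    simp only [Term.tsubst, Expr.tsubst]
    exact .var (by simp [h]) (htag.tsubst σ)
  | array _ hk hl htag ih =>
    have htag := htag.tsubst σ
    simp only [Term.tsubst, Expr.tsubst, Ty.tsubst] at htag ih ⊢
    exact .array (by simpa using fun a ha => ih a ha hσ) (hk.tsubst hσ) (by simpa using hl) htag
  | frame _ hk hl htag ih =>
    have htag := htag.tsubst σ
    have hk := hk.tsubst hσ
    simp only [Term.tsubst, Expr.tsubst, Ty.tsubst] at htag ih hk ⊢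
    exact .frame (by simpa using fun a ha => ih a ha hσ) hk (by simpa using hl) htag
  | @app Θ Δ Γ f es ps τo tag ιo ιf ιp _ hl _ hp htag ihf ih =>
    have htag := htag.tsubst σ
    have ihf := ihf hσ
    simp only [Term.tsubst, Expr.tsubst, Ty.tsubst, List.map_map] at htag ih ihf ⊢
    refine .app (ps := ps.map (ArgTy.tsubst σ))
      (by rw [ArgTy.map_param_tsubst, List.map_map]; exact ihf)
      (by simpa using hl) ?_ (by rw [List.map_map]; exact hp) htag
    intro i e p he hp
    simp only [List.getElem?_map, Option.map_eq_some_iff] at he hp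
    obtain ⟨e, he, rfl⟩ := he
    obtain ⟨p, hp, rfl⟩ := hp
    simpa [ArgTy.actual, ArgTy.tsubst, Ty.tsubst] using ih i e p he hp hσ
  | tapp _ ha htag ih =>
    have htag := htag.tsubst σ
    have ih := ih hσ
    simp only [Term.tsubst, Expr.tsubst, Ty.tsubst, Ty.tinst_tsubst, ha.length_eq]
      at htag ih ⊢
    exact .tapp ih (forall₂_kinded_tsubst hσ ha) htag
  | iapp _ ha htag ih =>
    have htag := htag.tsubst σ
    have ih := ih hσ
    simp only [Term.tsubst, Expr.tsubst, Ty.tsubst, Ty.iinst_tsubst, ha.length_eq] at htag ih ⊢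
    exact .iapp ih ha htag
  | unbox _ hn _ hk htag ih ihb =>
    subst hn
    have htag := htag.tsubst σ
    have hk := hk.tsubst hσ
    have ih := ih hσ
    have ihb := ihb (hσ.ishift _)
    rw [Ty.shift_tsubst_shift] at ihb
    simp only [Term.tsubst, Expr.tsubst, Ty.tsubst, List.map_cons,
      List.map_map, Function.comp_def, Ty.shift_tsubst_shift] at htag hk ih ihb ⊢
    refine .unbox ih rfl ?_ hk htag
    simpa [Function.comp_def] using ihb
  | base htag =>
    have htag := htag.tsubst σ
    simp only [Term.tsubst, Atom.tsubst, Ty.tsubst] at htag ⊢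
    exact .base htag
  | @op Θ Δ Γ o tag htag =>
    have htag := htag.tsubst σ
    rw [(S.opTy_kinded o).tsubst_eq_self (by simp)] at htag ⊢
    simp only [Term.tsubst, Atom.tsubst]
    exact .op htag
  | lam _ hk htag ih =>
    have htag := htag.tsubst σ
    have ih := ih hσ
    simp only [Term.tsubst, Atom.tsubst, Ty.tsubst, List.map_append] at htag ih ⊢
    refine .lam ih ?_ htag
    simpa using fun τ hτ => (hk τ hτ).tsubst hσ
  | @tlam Θ Δ ks Γ e τ tag hv _ htag ih =>
    have htag := htag.tsubst σ
    have ih := ih (hσ.lift _)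
    have hv := hv.tsubst (Ty.lift ks.length σ)
    simp only [Term.tsubst, Atom.tsubst, Ty.tsubst, List.map_map, Function.comp_def,
      Ty.shift_tsubst_lift] at htag ih hv ⊢
    refine .tlam hv ?_ htag
    simpa [Function.comp_def] using ih
  | @ilam Θ γs Δ Γ e τ tag hv _ htag ih =>
    have htag := htag.tsubst σ
    have ih := ih (hσ.ishift _)
    have hv := hv.tsubst fun x => (σ x).isubst (Idx.shift γs.length)
    simp only [Term.tsubst, Atom.tsubst, Ty.tsubst, List.map_map, Function.comp_def,
      Ty.shift_tsubst_shift] at htag ih hv ⊢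
    refine .ilam hv ?_ htag
    simpa [Function.comp_def] using ih
  | box hι hk _ htag ih =>
    have htag := htag.tsubst σ
    have hk := hk.tsubst hσ
    have ih := ih hσ
    simp only [Term.tsubst, Atom.tsubst, Ty.tsubst, Ty.iinst_tsubst, hι.length_eq]
      at htag hk ih ⊢
    exact .box hι hk ih htag

-- Typing under renaming and substitution of term variables.

theorem liftRen_getElem? {α : Type*} {Γ Γ' : List α} {r : ℕ → ℕ}
    (hr : ∀ x τ, Γ[x]? = some τ → Γ'[r x]? = some τ) (τs : List α) :
    ∀ x τ, (τs ++ Γ)[x]? = some τ → (τs ++ Γ')[liftRen τs.length r x]? = some τ := by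
  intro x τ h
  by_cases hx : x < τs.length
  · simpa [liftRen, hx, List.getElem?_append_left] using h
  · obtain ⟨y, rfl⟩ := Nat.exists_eq_add_of_le' (not_lt.1 hx)
    simpa [liftRen, List.getElem?_append_right] using
      hr y τ (by simpa [List.getElem?_append_right] using h)

theorem map_getElem?_of_getElem? {α β : Type*} {Γ Γ' : List α} {r : ℕ → ℕ}
    (hr : ∀ x τ, Γ[x]? = some τ → Γ'[r x]? = some τ) (f : α → β) :
    ∀ x τ, (Γ.map f)[x]? = some τ → (Γ'.map f)[r x]? = some τ := by
  intro x τ h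
  simp only [List.getElem?_map, Option.map_eq_some_iff] at h ⊢
  obtain ⟨a, h, rfl⟩ := h
  exact ⟨a, hr x a h, rfl⟩

/-- This is weakening in a form that passes under binders. It must precede the substitution lemma,
because pushing a substitution under a term binder renames the replacing expressions. -/
theorem HasType.rename {Θ : List Srt} {Δ : List Kind} {Γ Γ' : List (Ty B)} {t : Term B V O}
    {τ : Ty B} {r : ℕ → ℕ} (h : HasType S Θ Δ Γ t τ)
    (hr : ∀ x τ, Γ[x]? = some τ → Γ'[r x]? = some τ) :
    HasType S Θ Δ Γ' (t.rename r) τ := by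
  induction h generalizing Γ' r with
  | eqv _ he ih => exact .eqv (ih hr) he
  | var h htag =>
    simp only [Term.rename, Expr.rename]
    exact .var (hr _ _ h) htag
  | array _ hk hl htag ih =>
    simp only [Term.rename, Expr.rename] at ih ⊢
    exact .array (by simpa using fun a ha => ih a ha hr) hk (by simpa using hl) htag
  | frame _ hk hl htag ih =>
    simp only [Term.rename, Expr.rename] at ih ⊢
    exact .frame (by simpa using fun a ha => ih a ha hr) hk (by simpa using hl) htag
  | app _ hl _ hp htag ihf ih =>
    simp only [Term.rename, Expr.rename] at ihf ih ⊢
    refine .app (ihf hr) (by simpa using hl) ?_ hp htag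
    intro i e p he hp
    simp only [List.getElem?_map, Option.map_eq_some_iff] at he
    obtain ⟨e, he, rfl⟩ := he
    exact ih i e p he hp hr
  | tapp _ ha htag ih =>
    simp only [Term.rename, Expr.rename] at ih ⊢
    exact .tapp (ih hr) ha htag
  | iapp _ ha htag ih =>
    simp only [Term.rename, Expr.rename] at ih ⊢
    exact .iapp (ih hr) ha htag
  | @unbox Θ Δ Γ n s b γs τs τb tag ιs ιb _ hn _ hk htag ih ihb =>
    simp only [Term.rename, Expr.rename] at ih ihb ⊢
    exact .unbox (ih hr) hn (ihb (liftRen_getElem? (map_getElem?_of_getElem? hr _) [τs])) hk htag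
  | base htag => simp only [Term.rename, Atom.rename]; exact .base htag
  | op htag => simp only [Term.rename, Atom.rename]; exact .op htag
  | lam _ hk htag ih =>
    simp only [Term.rename, Atom.rename] at ih ⊢
    exact .lam (ih (liftRen_getElem? hr _)) hk htag
  | tlam hv _ htag ih =>
    have hv := hv.rename r
    simp only [Term.rename, Atom.rename] at hv ih ⊢
    exact .tlam hv (ih (map_getElem?_of_getElem? hr _)) htag
  | ilam hv _ htag ih =>
    have hv := hv.rename r
    simp only [Term.rename, Atom.rename] at hv ih ⊢
    exact .ilam hv (ih (map_getElem?_of_getElem? hr _)) htag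
  | box hι hk _ htag ih =>
    simp only [Term.rename, Atom.rename] at ih ⊢
    exact .box hι hk (ih hr) htag

/-- Substitutions for term variables that respect types. -/
def TypedSubst (S : Signature B V O) (Θ : List Srt) (Δ : List Kind) (Γ Γ' : List (Ty B))
    (s : TermSubst B V O) : Prop :=
  ∀ x τ, Γ[x]? = some τ →
    Sum.elim (fun y => Γ'[y]? = some τ) (fun e => HasType S Θ Δ Γ' (.expr e) τ) (s x)

theorem TypedSubst.lift {Θ : List Srt} {Δ : List Kind} {Γ Γ' : List (Ty B)}
    {s : TermSubst B V O} (hs : TypedSubst S Θ Δ Γ Γ' s) (τs : List (Ty B)) :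
    TypedSubst S Θ Δ (τs ++ Γ) (τs ++ Γ') (TermSubst.lift τs.length s) := by
  intro x τ h
  by_cases hx : x < τs.length
  · simpa [TermSubst.lift, hx, List.getElem?_append_left] using h
  · obtain ⟨y, rfl⟩ := Nat.exists_eq_add_of_le' (not_lt.1 hx)
    have := hs y τ (by simpa [List.getElem?_append_right] using h)
    simp only [TermSubst.lift, hx, if_false, Nat.add_sub_cancel]
    rcases hy : s y with z | e
    · rw [hy] at this
      simpa [List.getElem?_append_right] using this
    · rw [hy] at this
      exact HasType.rename (r := (· + τs.length)) this
        (by simp [List.getElem?_append_right])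

theorem TypedSubst.ilift {Θ : List Srt} {Δ : List Kind} {Γ Γ' : List (Ty B)}
    {s : TermSubst B V O} (hs : TypedSubst S Θ Δ Γ Γ' s) (γs : List Srt) :
    TypedSubst S (γs ++ Θ) Δ (Γ.map (Ty.isubst (Idx.shift γs.length)))
      (Γ'.map (Ty.isubst (Idx.shift γs.length))) (TermSubst.ilift γs.length s) := by
  intro x τ h
  simp only [List.getElem?_map, Option.map_eq_some_iff] at h
  obtain ⟨τ, h, rfl⟩ := h
  have := hs x τ h
  simp only [TermSubst.ilift]
  rcases hy : s x with z | e
  · rw [hy] at this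
    simpa using ⟨τ, this, rfl⟩
  · rw [hy] at this
    exact HasType.isubst this (.shift γs Θ)

theorem TypedSubst.tlift {Θ : List Srt} {Δ : List Kind} {Γ Γ' : List (Ty B)}
    {s : TermSubst B V O} (hs : TypedSubst S Θ Δ Γ Γ' s) (ks : List Kind) :
    TypedSubst S Θ (ks ++ Δ) (Γ.map (Ty.tsubst (Ty.shift ks.length)))
      (Γ'.map (Ty.tsubst (Ty.shift ks.length))) (TermSubst.tlift ks.length s) := by
  intro x τ h
  simp only [List.getElem?_map, Option.map_eq_some_iff] at h
  obtain ⟨τ, h, rfl⟩ := h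
  have := hs x τ h
  simp only [TermSubst.tlift]
  rcases hy : s x with z | e
  · rw [hy] at this
    simpa using ⟨τ, this, rfl⟩
  · rw [hy] at this
    exact HasType.tsubst this (.shift Θ ks Δ)

theorem TypedSubst.inst {Θ : List Srt} {Δ : List Kind} {Γ τs : List (Ty B)}
    {es : List (Expr B V O)}
    (h : List.Forall₂ (fun e τ => HasType S Θ Δ Γ (.expr e) τ) es τs) :
    TypedSubst S Θ Δ (τs ++ Γ) Γ (instList Sum.inl (es.map Sum.inr)) := by
  intro x τ hx
  have hl := h.length_eq
  by_cases hlt : x < τs.length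
  · rw [List.getElem?_append_left hlt, List.getElem?_eq_getElem hlt] at hx
    have hlt' : x < es.length := hl ▸ hlt
    cases hx
    simpa [instList, hlt'] using h.get hlt' hlt
  · obtain ⟨y, rfl⟩ := Nat.exists_eq_add_of_le' (not_lt.1 hlt)
    have := instList_add_length (Sum.inl : ℕ → ℕ ⊕ Expr B V O) (es.map Sum.inr) y
    rw [List.length_map, hl] at this
    rw [this]
    simpa [List.getElem?_append_right] using hx

theorem HasType.subst {Θ : List Srt} {Δ : List Kind} {Γ Γ' : List (Ty B)} {t : Term B V O}
    {τ : Ty B} {s : TermSubst B V O} (h : HasType S Θ Δ Γ t τ)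
    (hs : TypedSubst S Θ Δ Γ Γ' s) :
    HasType S Θ Δ Γ' (t.subst s) τ := by
  induction h generalizing Γ' s with
  | eqv _ he ih => exact .eqv (ih hs) he
  | @var Θ Δ Γ x τ tag h htag =>
    have := hs _ _ h
    simp only [Term.subst, Expr.subst]
    rcases hy : s x with z | e
    · rw [hy] at this
      exact .var this htag
    · rw [hy] at this
      exact this
  | array _ hk hl htag ih =>
    simp only [Term.subst, Expr.subst] at ih ⊢
    exact .array (by simpa using fun a ha => ih a ha hs) hk (by simpa using hl) htag
  | frame _ hk hl htag ih =>
    simp only [Term.subst, Expr.subst] at ih ⊢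
    exact .frame (by simpa using fun a ha => ih a ha hs) hk (by simpa using hl) htag
  | app _ hl _ hp htag ihf ih =>
    simp only [Term.subst, Expr.subst] at ihf ih ⊢
    refine .app (ihf hs) (by simpa using hl) ?_ hp htag
    intro i e p he hp
    simp only [List.getElem?_map, Option.map_eq_some_iff] at he
    obtain ⟨e, he, rfl⟩ := he
    exact ih i e p he hp hs
  | tapp _ ha htag ih =>
    simp only [Term.subst, Expr.subst] at ih ⊢
    exact .tapp (ih hs) ha htag
  | iapp _ ha htag ih =>
    simp only [Term.subst, Expr.subst] at ih ⊢
    exact .iapp (ih hs) ha htag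
  | @unbox Θ Δ Γ n s b γs τs τb tag ιs ιb _ hn _ hk htag ih ihb =>
    subst hn
    simp only [Term.subst, Expr.subst] at ih ihb ⊢
    -- The index binders come first: the type `τs` of the unpacked variable lives in the environment
    -- already extended by `γs`.
    exact .unbox (ih hs) rfl (ihb ((hs.ilift γs).lift [τs])) hk htag
  | base htag => simp only [Term.subst, Atom.subst]; exact .base htag
  | op htag => simp only [Term.subst, Atom.subst]; exact .op htag
  | lam _ hk htag ih =>
    simp only [Term.subst, Atom.subst] at ih ⊢
    exact .lam (ih (hs.lift _)) hk htag
  | @tlam Θ Δ ks Γ e τ tag hv _ htag ih =>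
    have hv := hv.subst (TermSubst.tlift ks.length s)
    simp only [Term.subst, Atom.subst] at hv ih ⊢
    exact .tlam hv (ih (hs.tlift _)) htag
  | @ilam Θ γs Δ Γ e τ tag hv _ htag ih =>
    have hv := hv.subst (TermSubst.ilift γs.length s)
    simp only [Term.subst, Atom.subst] at hv ih ⊢
    exact .ilam hv (ih (hs.ilift _)) htag
  | box hι hk _ htag ih =>
    simp only [Term.subst, Atom.subst] at ih ⊢
    exact .box hι hk (ih hs) htag

end Terms

-- Lengths and members of the lists built by the list functions.

section Lists

variable {α β : Type*}

theorem exists_mem_left_of_forall₂ {R : α → β → Prop} {l : List α} {l' : List β}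
    (h : List.Forall₂ R l l') : ∀ b ∈ l', ∃ a ∈ l, R a b := by
  induction h with
  | nil => simp
  | cons h _ ih =>
    intro b hb
    rcases List.mem_cons.1 hb with rfl | hb
    · exact ⟨_, by simp, h⟩
    · obtain ⟨a, ha, h⟩ := ih b hb
      exact ⟨a, by simp [ha], h⟩

theorem length_of_mem_split {k n : ℕ} {l p : List α} (hl : l.length = k * n)
    (hp : p ∈ split k n l) : p.length = n := by
  simp only [split, List.mem_map, List.mem_range] at hp
  obtain ⟨j, hj, rfl⟩ := hp
  have : (j + 1) * n ≤ k * n := Nat.mul_le_mul_right n hj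
  rw [Nat.succ_mul] at this
  simp only [List.length_take, List.length_drop, hl]
  omega

theorem subset_of_mem_split {k n : ℕ} {l p : List α} (hp : p ∈ split k n l) : p ⊆ l := by
  simp only [split, List.mem_map] at hp
  obtain ⟨j, -, rfl⟩ := hp
  exact fun x hx => List.mem_of_mem_drop (List.mem_of_mem_take hx)

theorem length_concat {n : ℕ} {L : List (List α)} (h : ∀ p ∈ L, p.length = n) :
    (concat L).length = L.length * n := by
  rw [concat, List.length_flatten, List.eq_replicate_of_mem (a := n) (l := L.map List.length)
    (by simpa using h)]
  simp

theorem length_concat_rep_split {k n : ℕ} (r : ℕ) {l : List α} (hl : l.length = k * n) :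
    (concat (rep r (split k n l))).length = k * r * n := by
  rw [length_concat (n := n)]
  · simp [rep, split, Function.comp_def]
  · intro p hp
    simp only [rep, List.mem_flatMap, List.mem_replicate] at hp
    obtain ⟨q, hq, -, rfl⟩ := hp
    exact length_of_mem_split hl hq

theorem mem_of_mem_concat_rep_split {k n r : ℕ} {l : List α} {x : α}
    (hx : x ∈ concat (rep r (split k n l))) : x ∈ l := by
  simp only [concat, rep, List.mem_flatten, List.mem_flatMap, List.mem_replicate] at hx
  obtain ⟨_, ⟨q, hq, -, rfl⟩, hx⟩ := hx
  exact subset_of_mem_split hq hx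

/-- Every `split m` has exactly `m` pieces, even when the pieces are empty. So for `j < m` the
`filterMap` inside `transpose` drops nothing, and a row holds one piece per argument, in order. -/
theorem forall₂_of_mem_transpose {m : ℕ} {c : α → ℕ} {g : α → List β} {l : List α}
    {xs : List (List β)} (h : xs ∈ transpose m (l.map fun a => split m (c a) (g a))) :
    List.Forall₂ (fun a x => x ∈ split m (c a) (g a)) l xs := by
  simp only [transpose, List.mem_map, List.mem_range] at h
  obtain ⟨j, hj, rfl⟩ := h
  induction l with
  | nil => simp
  | cons a l ih =>
    have hlt : j < (split m (c a) (g a)).length := by simpa [split] using hj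
    rw [List.map_cons, List.filterMap_cons_some (f := fun l : List (List β) => l[j]?)
      (List.getElem?_eq_getElem hlt)]
    exact .cons (List.getElem_mem hlt) ih

theorem forall₂_zipWith {γ : Type*} {R : α → β → Prop} {Q : α → γ → Prop} {f : α → β → γ}
    (hR : ∀ a b, R a b → Q a (f a b)) {l : List α} {l' : List β} (h : List.Forall₂ R l l') :
    List.Forall₂ Q l (List.zipWith f l l') := by
  induction h with
  | nil => simp
  | cons h _ ih => exact .cons (hR _ _ h) ih

theorem exists_of_mem_zipWith {γ : Type*} {f : α → β → γ} {l : List α} {l' : List β} {c : γ}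
    (h : c ∈ List.zipWith f l l') : ∃ a ∈ l, ∃ b ∈ l', c = f a b := by
  obtain ⟨i, hi, rfl⟩ := List.mem_iff_getElem.1 h
  simp only [List.length_zipWith, lt_inf_iff] at hi
  exact ⟨l[i], List.getElem_mem _, l'[i], List.getElem_mem _, by simp⟩

end Lists

section Preservation

variable {B V O : Type*} {S : Signature B V O} {Θ : List Srt} {Δ : List Kind} {Γ : List (Ty B)}

/-! ### Inversion of typing -/

/-- Any number of conversions may stand at the root of a derivation; transitivity of `TEqv`
collapses them into one. The other inversion lemmas work the same way. -/
theorem HasType.array_inv {ns : List ℕ} {as : List (Atom B V O)} {tag τ : Ty B}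
    (h : HasType S Θ Δ Γ (.expr (.array ns as tag)) τ) :
    ∃ τ', TEqv Θ τ (.arr τ' (shpLit ns)) ∧ (∀ a ∈ as, HasType S Θ Δ Γ (.atom a) τ') ∧
      Kinded Θ Δ τ' .atom ∧ as.length = ns.prod ∧ TEqv Θ tag (.arr τ' (shpLit ns)) := by
  generalize ht : Term.expr (Expr.array ns as tag) = t at h
  induction h with
  | eqv _ he ih =>
    obtain ⟨τ', h, h'⟩ := ih ht
    exact ⟨τ', he.trans h, h'⟩
  | array ha hk hl htag => cases ht; exact ⟨_, .refl _, ha, hk, hl, htag⟩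
  | _ => cases ht

theorem HasType.frame_inv {ns : List ℕ} {es : List (Expr B V O)} {tag τ : Ty B}
    (h : HasType S Θ Δ Γ (.expr (.frame ns es tag)) τ) :
    ∃ τ' ι, TEqv Θ τ (.arr τ' (.append [shpLit ns, ι])) ∧
      (∀ e ∈ es, HasType S Θ Δ Γ (.expr e) (.arr τ' ι)) ∧ Kinded Θ Δ (.arr τ' ι) .array ∧
      es.length = ns.prod ∧ TEqv Θ tag (.arr τ' (.append [shpLit ns, ι])) := by
  generalize ht : Term.expr (Expr.frame ns es tag) = t at h
  induction h with
  | eqv _ he ih =>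
    obtain ⟨τ', ι, h, h'⟩ := ih ht
    exact ⟨τ', ι, he.trans h, h'⟩
  | frame he hk hl htag => cases ht; exact ⟨_, _, .refl _, he, hk, hl, htag⟩
  | _ => cases ht

theorem HasType.app_inv {f : Expr B V O} {es : List (Expr B V O)} {tag τ : Ty B}
    (h : HasType S Θ Δ Γ (.expr (.app f es tag)) τ) :
    ∃ (ps : List (ArgTy B)) (τo : Ty B) (ιo ιf ιp : Idx),
      TEqv Θ τ (.arr τo (.append [ιp, ιo])) ∧
      HasType S Θ Δ Γ (.expr f) (.arr (.fn (ps.map ArgTy.param) (.arr τo ιo)) ιf) ∧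
      es.length = ps.length ∧
      (∀ (i : ℕ) (e : Expr B V O) (p : ArgTy B), es[i]? = some e → ps[i]? = some p →
        HasType S Θ Δ Γ (.expr e) p.actual) ∧
      IsMaxFrame Θ ιp (ιf :: ps.map ArgTy.frame) ∧ TEqv Θ tag (.arr τo (.append [ιp, ιo])) := by
  generalize ht : Term.expr (Expr.app f es tag) = t at h
  induction h with
  | eqv _ he ih =>
    obtain ⟨ps, τo, ιo, ιf, ιp, h, h'⟩ := ih ht
    exact ⟨ps, τo, ιo, ιf, ιp, he.trans h, h'⟩
  | app hf hl he hp htag => cases ht; exact ⟨_, _, _, _, _, .refl _, hf, hl, he, hp, htag⟩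
  | _ => cases ht

theorem HasType.tapp_inv {f : Expr B V O} {τs : List (Ty B)} {tag τ : Ty B}
    (h : HasType S Θ Δ Γ (.expr (.tapp f τs tag)) τ) :
    ∃ ks τu ιu ιf, TEqv Θ τ (.arr (τu.tinst τs) (.append [ιf, ιu])) ∧
      HasType S Θ Δ Γ (.expr f) (.arr (.univ ks (.arr τu ιu)) ιf) ∧
      List.Forall₂ (Kinded Θ Δ) τs ks ∧
      TEqv Θ tag (.arr (τu.tinst τs) (.append [ιf, ιu])) := by
  generalize ht : Term.expr (Expr.tapp f τs tag) = t at h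
  induction h with
  | eqv _ he ih =>
    obtain ⟨ks, τu, ιu, ιf, h, h'⟩ := ih ht
    exact ⟨ks, τu, ιu, ιf, he.trans h, h'⟩
  | tapp hf ha htag => cases ht; exact ⟨_, _, _, _, .refl _, hf, ha, htag⟩
  | _ => cases ht

theorem HasType.iapp_inv {f : Expr B V O} {ιs : List Idx} {tag τ : Ty B}
    (h : HasType S Θ Δ Γ (.expr (.iapp f ιs tag)) τ) :
    ∃ γs τp ιp ιf,
      TEqv Θ τ (.arr (τp.iinst ιs) (.append [ιf, ιp.subst (instList Idx.var ιs)])) ∧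
      HasType S Θ Δ Γ (.expr f) (.arr (.pi γs (.arr τp ιp)) ιf) ∧
      List.Forall₂ (Sorted Θ) ιs γs ∧
      TEqv Θ tag (.arr (τp.iinst ιs) (.append [ιf, ιp.subst (instList Idx.var ιs)])) := by
  generalize ht : Term.expr (Expr.iapp f ιs tag) = t at h
  induction h with
  | eqv _ he ih =>
    obtain ⟨γs, τp, ιp, ιf, h, h'⟩ := ih ht
    exact ⟨γs, τp, ιp, ιf, he.trans h, h'⟩
  | iapp hf ha htag => cases ht; exact ⟨_, _, _, _, .refl _, hf, ha, htag⟩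
  | _ => cases ht

theorem HasType.unbox_inv {n : ℕ} {s b : Expr B V O} {tag τ : Ty B}
    (h : HasType S Θ Δ Γ (.expr (.unbox n s b tag)) τ) :
    ∃ γs τs τb ιs ιb, TEqv Θ τ (.arr τb (.append [ιs, ιb])) ∧
      HasType S Θ Δ Γ (.expr s) (.arr (.sigma γs τs) ιs) ∧ n = γs.length ∧
      HasType S (γs ++ Θ) Δ (τs :: Γ.map (Ty.isubst (Idx.shift n))) (.expr b)
        ((Ty.arr τb ιb).isubst (Idx.shift n)) ∧
      Kinded Θ Δ (.arr τb ιb) .array ∧ TEqv Θ tag (.arr τb (.append [ιs, ιb])) := by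
  generalize ht : Term.expr (Expr.unbox n s b tag) = t at h
  induction h with
  | eqv _ he ih =>
    obtain ⟨γs, τs, τb, ιs, ιb, h, h'⟩ := ih ht
    exact ⟨γs, τs, τb, ιs, ιb, he.trans h, h'⟩
  | unbox hs hn hb hk htag => cases ht; exact ⟨_, _, _, _, _, .refl _, hs, hn, hb, hk, htag⟩
  | _ => cases ht

theorem HasType.op_inv {o : O} {tag τ : Ty B}
    (h : HasType S Θ Δ Γ (.atom (.op o tag)) τ) : TEqv Θ τ (S.opTy o) := by
  generalize ht : Term.atom (Atom.op o tag) = t at h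
  induction h with
  | eqv _ he ih => exact he.trans (ih ht)
  | op htag => cases ht; exact .refl _
  | _ => cases ht

theorem HasType.lam_inv {τs : List (Ty B)} {e : Expr B V O} {tag τ : Ty B}
    (h : HasType S Θ Δ Γ (.atom (.lam τs e tag)) τ) :
    ∃ τo, TEqv Θ τ (.fn τs τo) ∧ HasType S Θ Δ (τs ++ Γ) (.expr e) τo := by
  generalize ht : Term.atom (Atom.lam τs e tag) = t at h
  induction h with
  | eqv _ he ih =>
    obtain ⟨τo, h, h'⟩ := ih ht
    exact ⟨τo, he.trans h, h'⟩
  | lam he _ _ => cases ht; exact ⟨_, .refl _, he⟩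
  | _ => cases ht

theorem HasType.tlam_inv {ks : List Kind} {e : Expr B V O} {tag τ : Ty B}
    (h : HasType S Θ Δ Γ (.atom (.tlam ks e tag)) τ) :
    ∃ τ', TEqv Θ τ (.univ ks τ') ∧
      HasType S Θ (ks ++ Δ) (Γ.map (Ty.tsubst (Ty.shift ks.length))) (.expr e) τ' := by
  generalize ht : Term.atom (Atom.tlam ks e tag) = t at h
  induction h with
  | eqv _ he ih =>
    obtain ⟨τ', h, h'⟩ := ih ht
    exact ⟨τ', he.trans h, h'⟩
  | tlam _ he _ => cases ht; exact ⟨_, .refl _, he⟩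
  | _ => cases ht

theorem HasType.ilam_inv {γs : List Srt} {e : Expr B V O} {tag τ : Ty B}
    (h : HasType S Θ Δ Γ (.atom (.ilam γs e tag)) τ) :
    ∃ τ', TEqv Θ τ (.pi γs τ') ∧
      HasType S (γs ++ Θ) Δ (Γ.map (Ty.isubst (Idx.shift γs.length))) (.expr e) τ' := by
  generalize ht : Term.atom (Atom.ilam γs e tag) = t at h
  induction h with
  | eqv _ he ih =>
    obtain ⟨τ', h, h'⟩ := ih ht
    exact ⟨τ', he.trans h, h'⟩
  | ilam _ he _ => cases ht; exact ⟨_, .refl _, he⟩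
  | _ => cases ht

theorem HasType.box_inv {ιs : List Idx} {e : Expr B V O} {τ' tag τ : Ty B}
    (h : HasType S Θ Δ Γ (.atom (.box ιs e τ' tag)) τ) :
    ∃ γs τs, τ' = .sigma γs τs ∧ TEqv Θ τ (.sigma γs τs) ∧ List.Forall₂ (Sorted Θ) ιs γs ∧
      Kinded Θ Δ (.sigma γs τs) .atom ∧ HasType S Θ Δ Γ (.expr e) (τs.iinst ιs) ∧
      TEqv Θ tag (.sigma γs τs) := by
  generalize ht : Term.atom (Atom.box ιs e τ' tag) = t at h
  induction h with
  | eqv _ he ih =>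
    obtain ⟨γs, τs, h0, h, h'⟩ := ih ht
    exact ⟨γs, τs, h0, he.trans h, h'⟩
  | box hι hk he htag => cases ht; exact ⟨_, _, rfl, .refl _, hι, hk, he, htag⟩
  | _ => cases ht

/-! ### Regularity -/

theorem IdxEqv.append_sorted {Θ : List Srt} {ι ι' ι'' : Idx}
    (h : IdxEqv Θ (.append [ι, ι']) ι'') :
    Sorted Θ ι .shape ∧ Sorted Θ ι' .shape ∧ Sorted Θ ι'' .shape := by
  rcases h with ⟨h, -, -⟩ | ⟨h, h', -⟩
  · cases h
  · exact ⟨(sorted_append.1 h).1, (sorted_append.1 h).2, h'⟩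

theorem IsMaxFrame.sorted {Θ : List Srt} {ι : Idx} {ιs : List Idx} (h : IsMaxFrame Θ ι ιs) :
    Sorted Θ ι .shape := by
  obtain ⟨w, h⟩ := h.2 ι h.1
  exact h.append_sorted.1

/-- The kind of the types of a term. -/
def Term.kind : Term B V O → Kind
  | .expr _ => .array
  | .atom _ => .atom

theorem WfEnv.ishift (h : WfEnv Θ Δ Γ) (γs : List Srt) :
    WfEnv (γs ++ Θ) Δ (Γ.map (Ty.isubst (Idx.shift γs.length))) := by
  simpa [WfEnv] using fun τ hτ => (h τ hτ).isubst (.shift γs Θ)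

theorem WfEnv.tshift (h : WfEnv Θ Δ Γ) (ks : List Kind) :
    WfEnv Θ (ks ++ Δ) (Γ.map (Ty.tsubst (Ty.shift ks.length))) := by
  simpa [WfEnv] using fun τ hτ => (h τ hτ).tsubst (.shift Θ ks Δ)

theorem WfEnv.append {τs : List (Ty B)} (h : WfEnv Θ Δ Γ)
    (hk : ∀ τ ∈ τs, Kinded Θ Δ τ .array) : WfEnv Θ Δ (τs ++ Γ) :=
  fun τ hτ => (List.mem_append.1 hτ).elim (hk τ) (h τ)

theorem Kinded.univ_inv {ks : List Kind} {τ : Ty B} (h : Kinded Θ Δ (.univ ks τ) .atom) :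
    Kinded Θ (ks ++ Δ) τ .array := by
  cases h with | univ h => exact h

theorem Kinded.pi_inv {γs : List Srt} {τ : Ty B} (h : Kinded Θ Δ (.pi γs τ) .atom) :
    Kinded (γs ++ Θ) Δ τ .array := by
  cases h with | pi h => exact h

theorem Kinded.fn_inv {ins : List (Ty B)} {out : Ty B} (h : Kinded Θ Δ (.fn ins out) .atom) :
    (∀ τ ∈ ins, Kinded Θ Δ τ .array) ∧ Kinded Θ Δ out .array := by
  cases h with | fn h h' => exact ⟨h, h'⟩

/-- Only the variable case consults the environment. The frame, unbox and box rules carry the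
required kinding as a premise; for instantiations it comes from the type of the head by kind- and
sort-respecting substitution, and for applications from the output of the function type. -/
theorem HasType.kinded {t : Term B V O} {τ : Ty B} (h : HasType S Θ Δ Γ t τ)
    (hwf : WfEnv Θ Δ Γ) : Kinded Θ Δ τ t.kind := by
  induction h with
  | eqv _ he ih => exact he.symm.kinded (ih hwf)
  | var h _ => exact hwf _ (List.mem_of_getElem? h)
  | array _ hk _ _ _ => exact .arr hk (sorted_shpLit _ _)
  | frame _ hk _ _ _ =>
    obtain ⟨hk, hι⟩ := kinded_arr.1 hk
    exact .arr hk (sorted_append.2 ⟨sorted_shpLit _ _, hι⟩)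
  | app _ _ _ hp _ ih _ =>
    obtain ⟨hk, hι⟩ := kinded_arr.1 (kinded_arr.1 (ih hwf)).1.fn_inv.2
    exact .arr hk (sorted_append.2 ⟨hp.sorted, hι⟩)
  | tapp _ ha _ ih =>
    obtain ⟨hu, hf⟩ := kinded_arr.1 (ih hwf)
    obtain ⟨hk, hι⟩ := kinded_arr.1 hu.univ_inv
    exact .arr (hk.tsubst (.inst ha)) (sorted_append.2 ⟨hf, hι⟩)
  | iapp _ ha _ ih =>
    obtain ⟨hp, hf⟩ := kinded_arr.1 (ih hwf)
    obtain ⟨hk, hι⟩ := kinded_arr.1 hp.pi_inv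
    exact .arr (hk.isubst (.inst ha)) (sorted_append.2 ⟨hf, hι.subst (.inst ha)⟩)
  | unbox _ _ _ hk _ ih _ =>
    obtain ⟨hk, hι⟩ := kinded_arr.1 hk
    exact .arr hk (sorted_append.2 ⟨(kinded_arr.1 (ih hwf)).2, hι⟩)
  | base _ => exact .base _
  | @op Θ Δ Γ o tag _ => exact (S.opTy_kinded o).of_closed Θ Δ
  | lam _ hk _ ih => exact .fn hk (ih (hwf.append hk))
  | tlam _ _ _ ih => exact .univ (ih (hwf.tshift _))
  | ilam _ _ _ ih => exact .pi (ih (hwf.ishift _))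
  | box _ hk _ _ _ => exact hk

/-! ### Instantiation -/

theorem HasType.tinst {ks : List Kind} {τs : List (Ty B)} {e : Expr B V O} {τ : Ty B}
    (h : HasType S Θ (ks ++ Δ) (Γ.map (Ty.tsubst (Ty.shift ks.length))) (.expr e) τ)
    (ha : List.Forall₂ (Kinded Θ Δ) τs ks) :
    HasType S Θ Δ Γ (.expr (e.tinst τs)) (τ.tinst τs) := by
  have h := h.tsubst (.inst ha)
  have hΓ : (Γ.map (Ty.tsubst (Ty.shift ks.length))).map (Ty.tsubst (instList Ty.var τs)) = Γ := by
    rw [List.map_map, ← ha.length_eq]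
    exact (List.map_congr_left fun τ _ => Ty.shift_tinst τs τ).trans (List.map_id Γ)
  rw [hΓ] at h
  exact h

theorem map_shift_iinst (ιs : List Idx) (Γ : List (Ty B)) :
    (Γ.map (Ty.isubst (Idx.shift ιs.length))).map (Ty.isubst (instList Idx.var ιs)) = Γ := by
  rw [List.map_map]
  exact (List.map_congr_left fun τ _ => Ty.shift_iinst ιs τ).trans (List.map_id Γ)

theorem HasType.iinst {γs : List Srt} {ιs : List Idx} {e : Expr B V O} {τ : Ty B}
    (h : HasType S (γs ++ Θ) Δ (Γ.map (Ty.isubst (Idx.shift γs.length))) (.expr e) τ)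
    (ha : List.Forall₂ (Sorted Θ) ιs γs) :
    HasType S Θ Δ Γ (.expr (e.iinst ιs)) (τ.iinst ιs) := by
  have h := h.isubst (.inst ha)
  rw [← ha.length_eq, map_shift_iinst] at h
  exact h

theorem HasType.inst {τs : List (Ty B)} {es : List (Expr B V O)} {e : Expr B V O} {τ : Ty B}
    (h : HasType S Θ Δ (τs ++ Γ) (.expr e) τ)
    (hes : List.Forall₂ (fun e τ => HasType S Θ Δ Γ (.expr e) τ) es τs) :
    HasType S Θ Δ Γ (.expr (e.inst es)) τ :=
  HasType.subst h (.inst hes)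

/-! ### Applications of function arrays -/

/-- The typing of an argument array, with the element type and cell shape that the tag of the
function array prescribes. -/
structure ArrArg.Typed (S : Signature B V O) (Θ : List Srt) (Δ : List Kind) (Γ : List (Ty B))
    (a : ArrArg B V O) : Prop where
  kinded : Kinded Θ Δ a.elt .atom
  shape : IdxEqv Θ a.shape (shpLit a.cell)
  atoms : ∀ x ∈ a.atoms, HasType S Θ Δ Γ (.atom x) a.elt
  length : a.atoms.length = (a.frame ++ a.cell).prod
  expr : HasType S Θ Δ Γ (.expr a.expr) (.arr a.elt (shpLit (a.frame ++ a.cell)))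

/-- Reduction knows no sort environment and compares shapes in the empty one; this transports its
side conditions to the environment of the typing. -/
theorem IdxEqv.of_closed {ι ι' : Idx} (h : IdxEqv [] ι ι') (Θ : List Srt) : IdxEqv Θ ι ι' := by
  have := h.subst (SortedSubst.nil Θ Idx.var)
  rwa [Idx.subst_var, Idx.subst_var] at this

theorem idxEqv_append_shpLit {ι : Idx} {m : List ℕ} (n : List ℕ)
    (h : IdxEqv Θ ι (shpLit m)) :
    IdxEqv Θ (.append [shpLit n, ι]) (shpLit (n ++ m)) := by
  have hι := h.symm.sorted (sorted_shpLit Θ m)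
  exact .inr ⟨sorted_append.2 ⟨sorted_shpLit _ _, hι⟩, sorted_shpLit _ _,
    fun ρ => by simp [h.evalShape hι]⟩

theorem idxEqv_append_left {ι ι' ι'' : Idx} (h : IdxEqv Θ ι ι') (hι : Sorted Θ ι .shape)
    (hι' : Sorted Θ ι'' .shape) :
    IdxEqv Θ (.append [ι, ι'']) (.append [ι', ι'']) :=
  .inr ⟨sorted_append.2 ⟨hι, hι'⟩, sorted_append.2 ⟨h.sorted hι, hι'⟩,
    fun ρ => by simp [h.evalShape hι]⟩

theorem idxEqv_append_nil {ι : Idx} (hι : Sorted Θ ι .shape) :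
    IdxEqv Θ (.append [shpLit [], ι]) ι :=
  .inr ⟨sorted_append.2 ⟨sorted_shpLit _ _, hι⟩, hι, fun ρ => by simp⟩

/-- Right cancellation in the free monoid: with the cell shape known, the shape of the whole array
determines its frame. -/
theorem idxEqv_shpLit_of_append {ι ι' : Idx} {n m : List ℕ}
    (h : IdxEqv Θ (.append [ι, ι']) (shpLit (n ++ m))) (h' : IdxEqv Θ ι' (shpLit m)) :
    IdxEqv Θ ι (shpLit n) := by
  obtain ⟨hι, hι', -⟩ := h.append_sorted
  refine .inr ⟨hι, sorted_shpLit _ _, fun ρ => ?_⟩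
  have e := h.evalShape (sorted_append.2 ⟨hι, hι'⟩) ρ
  simpa [h'.evalShape hι' ρ] using e

theorem prefix_of_idxPrefix {ι ι' : Idx} {n m : List ℕ} (h : IdxPrefix Θ ι ι')
    (hn : IdxEqv Θ ι (shpLit n)) (hm : IdxEqv Θ ι' (shpLit m)) : n <+: m := by
  obtain ⟨w, h⟩ := h
  obtain ⟨hι, hw, hι'⟩ := h.append_sorted
  -- Both ends of the prefix relation are equivalent to literals, whose value does not depend on the
  -- interpretation, so an arbitrary one suffices.
  have e := h.evalShape (sorted_append.2 ⟨hι, hw⟩) ⟨fun _ => 0, fun _ => []⟩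
  rw [evalShape_append, hn.evalShape hι, hm.evalShape hι', evalShape_shpLit,
    evalShape_shpLit] at e
  exact ⟨_, e⟩

theorem TEqv.eq_arr {Θ : List Srt} {τ τ' : Ty B} {ι : Idx} (h : TEqv Θ τ (.arr τ' ι)) :
    ∃ τ'' ι', τ = .arr τ'' ι' := by
  cases h <;> exact ⟨_, _, rfl⟩

/-- The shape literals of the frames determine the principal frame of an application. -/
theorem IsMaxFrame.eq_shpLit {ι : Idx} {ιs : List Idx} {ns : List (List ℕ)}
    (h : IsMaxFrame Θ ι ιs) (hn : List.Forall₂ (fun n ι => IdxEqv Θ ι (shpLit n)) ns ιs) :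
    ∃ n ∈ ns, IdxEqv Θ ι (shpLit n) ∧ ∀ m ∈ ns, m <+: n := by
  obtain ⟨n, hmem, hι⟩ := exists_mem_left_of_forall₂ hn ι h.1
  refine ⟨n, hmem, hι, fun m hm => ?_⟩
  obtain ⟨ι', hι', hm⟩ := exists_mem_left_of_forall₂ hn.flip m hm
  exact prefix_of_idxPrefix (h.2 ι' hι') hm hι

/-- The contracta of lifting and mapping are tagged with types read off the function array's tag, so
the whole typing is restated in terms of that tag and of literal frames, instead of the symbolic
data that the derivation happened to choose. -/
theorem HasType.app_array_inv {nf : List ℕ} {fs : List (Atom B V O)}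
    {args : List (ArrArg B V O)} {out tag τ : Ty B} {ιf : Idx}
    (h : HasType S Θ Δ Γ (.expr (.app (.array nf fs (.arr (.fn (args.map ArrArg.param) out) ιf))
      (args.map ArrArg.expr) tag)) τ)
    (hargs : ∀ a ∈ args, a.Ok) :
    ∃ τo ιo, ∃ np ∈ nf :: args.map ArrArg.frame, out = .arr τo ιo ∧
      (∀ n ∈ nf :: args.map ArrArg.frame, n <+: np) ∧
      TEqv Θ τ (.arr τo (.append [shpLit np, ιo])) ∧
      TEqv Θ tag (.arr τo (.append [shpLit np, ιo])) ∧
      Kinded Θ Δ (.fn (args.map ArrArg.param) (.arr τo ιo)) .atom ∧ fs.length = nf.prod ∧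
      (∀ f ∈ fs, HasType S Θ Δ Γ (.atom f) (.fn (args.map ArrArg.param) (.arr τo ιo))) ∧
      ∀ a ∈ args, a.Typed S Θ Δ Γ := by
  obtain ⟨ps, τo', ιo', ιf', ιp, hτ, hf, hl, he, hp, htag⟩ := h.app_inv
  obtain ⟨τ0, hτ0, hfs, hk, hlf, htagf⟩ := hf.array_inv
  -- Reversing the equivalence puts the literal shape, which is always well sorted, on the side
  -- where `TEqv.arr_inv` asks for a sort.
  obtain ⟨h1, hιf⟩ := hτ0.symm.arr_inv (sorted_shpLit _ _)
  obtain ⟨h2, -⟩ := htagf.symm.arr_inv (sorted_shpLit _ _)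
  -- The function type in the tag and the one in the application rule are both equivalent to the
  -- element type `τ0` of the array, so their inputs and outputs agree up to equivalence.
  obtain ⟨hps, hout⟩ := (h2.symm.trans h1).fn_inv
  obtain ⟨τo, ιo, rfl⟩ := hout.eq_arr
  -- Kinding comes from the premise of the array rule, so regularity, and with it well-formedness of
  -- the environment, is not called upon here.
  have hkf := h2.kinded hk
  obtain ⟨hkp, hko⟩ := hkf.fn_inv
  obtain ⟨hτo, hιo⟩ := hout.arr_inv (kinded_arr.1 hko).2
  have hsp := hp.sorted
  have hargs' : ∀ (i : ℕ) a p, args[i]? = some a → ps[i]? = some p →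
      a.Typed S Θ Δ Γ ∧ IdxEqv Θ p.frame (shpLit a.frame) := by
    intro i a p ha hp
    have hmem := List.mem_of_getElem? ha
    obtain ⟨hka, hsa⟩ := kinded_arr.1 (hkp _ (List.mem_map_of_mem hmem))
    have hap : TEqv Θ a.param p.param := by
      have hi := (List.getElem?_eq_some_iff.1 ha).1
      have hi' := (List.getElem?_eq_some_iff.1 hp).1
      have := hps.get (i := i) (by simpa using hi) (by simpa using hi')
      simpa [(List.getElem?_eq_some_iff.1 ha).2, (List.getElem?_eq_some_iff.1 hp).2] using this
    obtain ⟨helt, hcell⟩ := hap.arr_inv hsa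
    have hshape := (hargs a hmem).2.of_closed Θ
    have hte := he i a.expr p (by simp [ha]) hp
    obtain ⟨τ1, hτ1, hat, hk1, hlen, htag1⟩ := HasType.array_inv hte
    obtain ⟨h3, h4⟩ := hτ1.symm.arr_inv (sorted_shpLit _ _)
    have h5 := helt.trans h3.symm
    exact ⟨⟨hka, hshape, fun x hx => (hat x hx).eqv h5, hlen,
      (HasType.array hat hk1 hlen htag1).eqv (.arr h5 (.inr ⟨sorted_shpLit _ _,
        sorted_shpLit _ _, fun _ => rfl⟩))⟩,
      idxEqv_shpLit_of_append h4.symm (hcell.symm.trans hshape)⟩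
  have hlen : args.length = ps.length := by simpa using hl
  have hfr : List.Forall₂ (fun n ι => IdxEqv Θ ι (shpLit n)) (nf :: args.map ArrArg.frame)
      (ιf' :: ps.map ArgTy.frame) := by
    refine .cons hιf.symm (List.forall₂_map_left_iff.2 (List.forall₂_map_right_iff.2
      (List.forall₂_iff_get.2 ⟨hlen, fun i hi hi' => (hargs' i _ _ ?_ ?_).2⟩))) <;> simp
  obtain ⟨np, hnp, hιp, hmax⟩ := hp.eq_shpLit hfr
  have hres : TEqv Θ (.arr τo' (.append [ιp, ιo'])) (.arr τo (.append [shpLit np, ιo])) := by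
    have hso := (kinded_arr.1 hko).2
    refine .arr hτo.symm (.inr ⟨sorted_append.2 ⟨hsp, hιo.sorted hso⟩,
      sorted_append.2 ⟨sorted_shpLit _ _, hso⟩, fun ρ => ?_⟩)
    simp [hιp.evalShape hsp, hιo.evalShape hso]
  refine ⟨τo, ιo, np, hnp, rfl, hmax, hτ.trans hres, htag.trans hres, hkf, hlf,
    fun f hf => (hfs f hf).eqv h2.symm, fun a ha => ?_⟩
  obtain ⟨i, hi, rfl⟩ := List.mem_iff_getElem.1 ha
  exact (hargs' i _ (ps[i]'(hlen ▸ hi)) (by simp) (by simp)).1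

/-- Typing an array asks only for the types and the number of its atoms, not for their order. One
statement thus covers replicated arguments, with `n` the principal frame, and single cells, with `n`
empty. -/
theorem ArrArg.Typed.array {a : ArrArg B V O} (h : a.Typed S Θ Δ Γ) {n : List ℕ}
    {xs : List (Atom B V O)} (hx : ∀ x ∈ xs, x ∈ a.atoms) (hl : xs.length = n.prod * a.cell.prod) :
    HasType S Θ Δ Γ (.expr (.array (n ++ a.cell) xs (.arr a.elt (shpLit (n ++ a.cell)))))
      (.arr a.elt (.append [shpLit n, a.shape])) :=
  .eqv (.array (fun x h' => h.atoms x (hx x h')) h.kinded (by simpa using hl) (.refl _))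
    (.arr (.refl _) (idxEqv_append_shpLit n h.shape))

/-- With one literal frame shared by function and arguments, that frame is trivially principal. -/
theorem HasType.app_array {n : List ℕ} {fs : List (Atom B V O)} {args : List (ArrArg B V O)}
    {es : List (Expr B V O)} {τo tag : Ty B} {ιo : Idx}
    (hfs : ∀ f ∈ fs, HasType S Θ Δ Γ (.atom f) (.fn (args.map ArrArg.param) (.arr τo ιo)))
    (hk : Kinded Θ Δ (.fn (args.map ArrArg.param) (.arr τo ιo)) .atom)
    (hl : fs.length = n.prod)
    (he : List.Forall₂ (fun a e => HasType S Θ Δ Γ (.expr e)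
      (.arr a.elt (.append [shpLit n, a.shape]))) args es)
    (htag : TEqv Θ tag (.arr τo (.append [shpLit n, ιo]))) :
    HasType S Θ Δ Γ (.expr (.app
      (.array n fs (.arr (.fn (args.map ArrArg.param) (.arr τo ιo)) (shpLit n))) es tag))
      (.arr τo (.append [shpLit n, ιo])) := by
  refine .app (ps := args.map fun a => ⟨a.elt, a.shape, shpLit n⟩) (ιf := shpLit n) ?_
    (by simpa using he.length_eq.symm) ?_ ⟨by simp, ?_⟩ htag
  · have : (args.map fun a => (⟨a.elt, a.shape, shpLit n⟩ : ArgTy B)).map ArgTy.param =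
        args.map ArrArg.param := by
      simp [ArgTy.param, ArrArg.param]
    rw [this]
    exact .array hfs hk hl (.refl _)
  · intro i e p hi hp
    simp only [List.getElem?_map, Option.map_eq_some_iff] at hp
    obtain ⟨a, ha, rfl⟩ := hp
    obtain ⟨hlt, rfl⟩ := List.getElem?_eq_some_iff.1 hi
    obtain ⟨hi', rfl⟩ := List.getElem?_eq_some_iff.1 ha
    exact he.get hi' hlt
  · intro ι hι
    have : ι = shpLit n := by
      rcases List.mem_cons.1 hι with h | h
      · exact h
      · simp only [List.map_map, List.mem_map] at h
        obtain ⟨a, -, rfl⟩ := h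
        rfl
    subst this
    -- The empty shape witnesses that a frame is a prefix of itself.
    refine ⟨shpLit [], ?_⟩
    have := idxEqv_append_shpLit (Θ := Θ) (ι := shpLit []) (m := []) n
      (.inr ⟨sorted_shpLit _ _, sorted_shpLit _ _, fun _ => rfl⟩)
    simpa using this

theorem HasType.lift {nf np : List ℕ} {fs : List (Atom B V O)} {args : List (ArrArg B V O)}
    {out tag τ : Ty B} {ιf : Idx}
    (h : HasType S Θ Δ Γ (.expr (.app (.array nf fs (.arr (.fn (args.map ArrArg.param) out) ιf))
      (args.map ArrArg.expr) tag)) τ)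
    (hargs : ∀ a ∈ args, a.Ok)
    (hmem : np ∈ nf :: args.map ArrArg.frame)
    (hmax : ∀ n ∈ nf :: args.map ArrArg.frame, n <+: np) :
    HasType S Θ Δ Γ (.expr (.app
      (.array np (concat (rep (np.drop nf.length).prod (split nf.prod 1 fs)))
        (.arr (.fn (args.map ArrArg.param) out) (shpLit np)))
      (args.map (ArrArg.lifted np)) tag)) τ := by
  obtain ⟨τo, ιo, np', hmem', rfl, hmax', hτ, htag, hk, hl, hfs, hty⟩ :=
    h.app_array_inv hargs
  -- The principal frames of the typing and of the reduction rule are both among the frames and both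
  -- extend all of them, so each is a prefix of the other.
  obtain rfl : np' = np := List.IsPrefix.eq_of_length_le (hmax _ hmem') (hmax' _ hmem).length_le
  -- The number of cells times the replication factor is the size of the principal frame.
  have hprod : ∀ n, n <+: np' → n.prod * (np'.drop n.length).prod = np'.prod := by
    rintro n ⟨t, rfl⟩
    simp
  refine .eqv (.app_array (fun f hf => hfs f (mem_of_mem_concat_rep_split hf)) hk ?_ ?_ htag) hτ
  · rw [length_concat_rep_split _ (by simpa using hl), mul_one]
    exact hprod nf (hmax nf (by simp))
  · refine List.forall₂_map_right_iff.2 (List.forall₂_same.2 fun a ha => ?_)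
    refine (hty a ha).array (fun x hx => mem_of_mem_concat_rep_split hx) ?_
    rw [length_concat_rep_split _ (by simpa using (hty a ha).length)]
    rw [hprod a.frame (hmax _ (by simpa using .inr ⟨a, ha, rfl⟩))]

theorem HasType.map {nf : List ℕ} {fs : List (Atom B V O)} {args : List (ArrArg B V O)}
    {out tag τ : Ty B} {ιf : Idx}
    (h : HasType S Θ Δ Γ (.expr (.app (.array nf fs (.arr (.fn (args.map ArrArg.param) out) ιf))
      (args.map ArrArg.expr) tag)) τ)
    (hargs : ∀ a ∈ args, a.Ok) (hframe : ∀ a ∈ args, a.frame = nf) :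
    HasType S Θ Δ Γ (.expr (.frame nf (mapCells nf fs args out) tag)) τ := by
  obtain ⟨τo, ιo, np, hmem, rfl, -, hτ, htag, hk, hl, hfs, hty⟩ := h.app_array_inv hargs
  obtain rfl : np = nf := by
    rcases List.mem_cons.1 hmem with h | h
    · exact h
    · obtain ⟨a, ha, rfl⟩ := List.mem_map.1 h
      exact hframe a ha
  have hko := hk.fn_inv.2
  -- The application rule puts an empty principal frame in front of each cell's result shape, while
  -- the cells are tagged with `out` itself; this equivalence bridges the two.
  have hnil := idxEqv_append_nil (kinded_arr.1 hko).2
  refine .eqv (.frame (fun c hc => ?_) hko (by simp [mapCells, transpose, hl]) htag) hτ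
  obtain ⟨f, hf, xs, hxs, rfl⟩ := exists_of_mem_zipWith hc
  refine .eqv (.app_array (n := []) (by simpa using hfs f hf) hk (by simp) ?_
    (.arr (.refl _) hnil.symm)) (.arr (.refl _) hnil.symm)
  refine forall₂_zipWith (R := fun a x => a.Typed S Θ Δ Γ ∧ a ∈ args ∧
    x ∈ split np.prod a.cell.prod a.atoms) (fun a x h => ?_) ((List.forall₂_and_left _ _).2
      ⟨hty, (List.forall₂_and_left _ _).2 ⟨fun _ => id, forall₂_of_mem_transpose hxs⟩⟩)
  obtain ⟨ha, hmem, hx⟩ := h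
  refine ha.array (n := []) (fun y hy => subset_of_mem_split hx hy) ?_
  have := ha.length
  rw [hframe a hmem, List.prod_append] at this
  simpa using length_of_mem_split this hx

theorem HasType.app_scalar_inv {f : Atom B V O} {args : List (ArrArg B V O)}
    {out tag τ : Ty B} {ιf : Idx}
    (h : HasType S Θ Δ Γ (.expr (.app (.array [] [f] (.arr (.fn (args.map ArrArg.param) out) ιf))
      (args.map ArrArg.expr) tag)) τ)
    (hargs : ∀ a ∈ args, a.Ok) (hframe : ∀ a ∈ args, a.frame = []) :
    TEqv Θ τ out ∧ HasType S Θ Δ Γ (.atom f) (.fn (args.map ArrArg.param) out) ∧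
      ∀ a ∈ args, HasType S Θ Δ Γ (.expr a.expr) a.param := by
  obtain ⟨τo, ιo, np, hmem, rfl, -, hτ, htag, hk, hl, hfs, hty⟩ := h.app_array_inv hargs
  obtain rfl : np = [] := by
    rcases List.mem_cons.1 hmem with h | h
    · exact h
    · obtain ⟨a, ha, rfl⟩ := List.mem_map.1 h
      exact hframe a ha
  refine ⟨hτ.trans (.arr (.refl _) (idxEqv_append_nil (kinded_arr.1 hk.fn_inv.2).2)),
    hfs f (by simp), fun a ha => (hty a ha).expr.eqv (.arr (.refl _) ?_)⟩
  rw [hframe a ha]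
  exact (hty a ha).shape

/-- The parameter annotations of the `λ` and the inputs in the tag agree only up to equivalence. The
arguments are converted to the former before substituting, and the type of the body is converted
back to the output type afterwards. -/
theorem HasType.beta {τs : List (Ty B)} {e : Expr B V O} {args : List (ArrArg B V O)}
    {out tag tag' τ : Ty B} {ιf : Idx}
    (h : HasType S Θ Δ Γ (.expr (.app
      (.array [] [.lam τs e tag'] (.arr (.fn (args.map ArrArg.param) out) ιf))
      (args.map ArrArg.expr) tag)) τ)
    (hargs : ∀ a ∈ args, a.Ok) (hframe : ∀ a ∈ args, a.frame = []) :
    HasType S Θ Δ Γ (.expr (e.inst (args.map ArrArg.expr))) τ := by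
  obtain ⟨hτ, hf, hes⟩ := h.app_scalar_inv hargs hframe
  obtain ⟨τo, hfn, he⟩ := hf.lam_inv
  obtain ⟨hins, hout⟩ := hfn.fn_inv
  refine (he.inst ?_).eqv (hτ.trans hout)
  rw [List.forall₂_map_left_iff] at hins ⊢
  exact ((List.forall₂_and_left _ _).2 ⟨hes, hins⟩).imp fun a τ h => h.1.eqv h.2.symm

theorem HasType.delta {δ : O → List (Expr B V O) → Option (Expr B V O)} (hδ : DeltaSound S δ)
    {o : O} {args : List (ArrArg B V O)} {out tag tag' τ : Ty B} {ιf : Idx} {r : Expr B V O}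
    (h : HasType S Θ Δ Γ (.expr (.app
      (.array [] [.op o tag'] (.arr (.fn (args.map ArrArg.param) out) ιf))
      (args.map ArrArg.expr) tag)) τ)
    (hwf : WfEnv Θ Δ Γ) (hargs : ∀ a ∈ args, a.Ok) (hframe : ∀ a ∈ args, a.frame = [])
    (hr : δ o (args.map ArrArg.expr) = some r) :
    HasType S Θ Δ Γ (.expr r) τ := by
  obtain ⟨hτ, hf, hes⟩ := h.app_scalar_inv hargs hframe
  have hop := hf.op_inv
  obtain ⟨ins, out', ho⟩ : ∃ ins out', S.opTy o = .fn ins out' := by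
    -- Nothing in the signature says that an operator has a function type; being equivalent to one
    -- forces it.
    generalize S.opTy o = σ at hop
    cases hop <;> exact ⟨_, _, rfl⟩
  rw [ho] at hop
  obtain ⟨hins, hout⟩ := hop.fn_inv
  refine (hδ Θ Δ Γ o ins out' _ r hwf ho ?_ ?_ hr).eqv (hτ.trans hout)
  · rintro _ hv
    obtain ⟨a, ha, rfl⟩ := List.mem_map.1 hv
    exact .array (hargs a ha).1
  · rw [List.forall₂_map_left_iff] at hins ⊢
    exact ((List.forall₂_and_left _ _).2 ⟨hes, hins⟩).imp fun a τ h => h.1.eqv h.2.symm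

/-! ### The other redexes -/

theorem HasType.tbeta {nf : List ℕ} {fs : List (Atom B V O)} {cells : List (Expr B V O)}
    {τs : List (Ty B)} {tag tag' τ : Ty B}
    (ht : HasType S Θ Δ Γ (.expr (.tapp (.array nf fs tag') τs tag)) τ) (hwf : WfEnv Θ Δ Γ)
    (h : List.Forall₂ (fun f c => ∃ ks e t, f = Atom.tlam ks e t ∧
      ks.length = τs.length ∧ c = e.tinst τs) fs cells) :
    HasType S Θ Δ Γ (.expr (.frame nf cells tag)) τ := by
  obtain ⟨ks, τu, ιu, ιf, hτ, hf, ha, htag⟩ := ht.tapp_inv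
  obtain ⟨hu, hιf⟩ := kinded_arr.1 (hf.kinded hwf)
  obtain ⟨hk, hιu⟩ := kinded_arr.1 hu.univ_inv
  obtain ⟨τ0, hτ0, hfs, -, hl, -⟩ := hf.array_inv
  obtain ⟨h1, h2⟩ := hτ0.arr_inv hιf
  have hres : TEqv Θ (.arr (τu.tinst τs) (.append [ιf, ιu]))
      (.arr (τu.tinst τs) (.append [shpLit nf, ιu])) :=
    .arr (.refl _) (idxEqv_append_left h2 hιf hιu)
  refine .eqv (.frame (fun c hc => ?_) (.arr (hk.tsubst (.inst ha)) hιu)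
    (h.length_eq.symm.trans hl) (htag.trans hres)) (hτ.trans hres)
  obtain ⟨_, hmem, ks', e, t, rfl, -, rfl⟩ := exists_mem_left_of_forall₂ h c hc
  obtain ⟨τ1, hτ1, he⟩ := (hfs _ hmem).tlam_inv
  -- Equivalent universal types bind literally the same kinds, so the argument kinding checked at
  -- the application fits the binder of every abstraction in the array.
  obtain ⟨rfl, h3⟩ := (h1.trans hτ1).univ_inv
  simpa [Ty.tinst, Ty.tsubst] using (he.eqv h3).tinst ha

theorem HasType.ibeta {nf : List ℕ} {fs : List (Atom B V O)} {cells : List (Expr B V O)}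
    {ιs : List Idx} {tag tag' τ : Ty B}
    (ht : HasType S Θ Δ Γ (.expr (.iapp (.array nf fs tag') ιs tag)) τ) (hwf : WfEnv Θ Δ Γ)
    (h : List.Forall₂ (fun f c => ∃ γs e t, f = Atom.ilam γs e t ∧
      γs.length = ιs.length ∧ c = e.iinst ιs) fs cells) :
    HasType S Θ Δ Γ (.expr (.frame nf cells tag)) τ := by
  obtain ⟨γs, τp, ιp, ιf, hτ, hf, ha, htag⟩ := ht.iapp_inv
  obtain ⟨hu, hιf⟩ := kinded_arr.1 (hf.kinded hwf)
  obtain ⟨hk, hιp⟩ := kinded_arr.1 hu.pi_inv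
  have hιp' := hιp.subst (.inst ha)
  obtain ⟨τ0, hτ0, hfs, -, hl, -⟩ := hf.array_inv
  obtain ⟨h1, h2⟩ := hτ0.arr_inv hιf
  have hres : TEqv Θ (.arr (τp.iinst ιs) (.append [ιf, ιp.subst (instList Idx.var ιs)]))
      (.arr (τp.iinst ιs) (.append [shpLit nf, ιp.subst (instList Idx.var ιs)])) :=
    .arr (.refl _) (idxEqv_append_left h2 hιf hιp')
  refine .eqv (.frame (fun c hc => ?_) (.arr (hk.isubst (.inst ha)) hιp')
    (h.length_eq.symm.trans hl) (htag.trans hres)) (hτ.trans hres)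
  obtain ⟨_, hmem, γs', e, t, rfl, -, rfl⟩ := exists_mem_left_of_forall₂ h c hc
  obtain ⟨τ1, hτ1, he⟩ := (hfs _ hmem).ilam_inv
  obtain ⟨rfl, h3⟩ := (h1.trans hτ1).pi_inv
  simpa [Ty.iinst, Ty.isubst] using (he.eqv h3).iinst ha

theorem HasType.unbox_array {ns : List ℕ} {bs : List (Atom B V O)} {cells : List (Expr B V O)}
    {n : ℕ} {b : Expr B V O} {tag tag' τ : Ty B}
    (ht : HasType S Θ Δ Γ (.expr (.unbox n (.array ns bs tag') b tag)) τ) (hwf : WfEnv Θ Δ Γ)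
    (h : List.Forall₂ (fun a c => ∃ ιs v τ t, a = Atom.box ιs v τ t ∧
      IsValue (.expr v) ∧ ιs.length = n ∧ c = (b.iinst ιs).inst [v]) bs cells) :
    HasType S Θ Δ Γ (.expr (.frame ns cells tag)) τ := by
  obtain ⟨γs, τs, τb, ιs, ιb, hτ, hs, rfl, hb, hk, htag⟩ := ht.unbox_inv
  obtain ⟨-, hιs⟩ := kinded_arr.1 (hs.kinded hwf)
  obtain ⟨τ0, hτ0, hbs, -, hl, -⟩ := hs.array_inv
  obtain ⟨h1, h2⟩ := hτ0.arr_inv hιs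
  have hres : TEqv Θ (.arr τb (.append [ιs, ιb])) (.arr τb (.append [shpLit ns, ιb])) :=
    .arr (.refl _) (idxEqv_append_left h2 hιs (kinded_arr.1 hk).2)
  refine .eqv (.frame (fun c hc => ?_) hk (h.length_eq.symm.trans hl) (htag.trans hres))
    (hτ.trans hres)
  obtain ⟨_, hmem, ιs', v, τ', t, rfl, -, -, rfl⟩ := exists_mem_left_of_forall₂ h c hc
  obtain ⟨γs', τs', rfl, hτ', hι, -, hv, -⟩ := (hbs _ hmem).box_inv
  obtain ⟨rfl, h3⟩ := (h1.trans hτ').sigma_inv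
  have hb := hb.isubst (.inst hι)
  rw [← hι.length_eq, List.map_cons, map_shift_iinst] at hb
  have hb' : HasType S Θ Δ ([τs.iinst ιs'] ++ Γ) (.expr (b.iinst ιs')) (.arr τb ιb) := by
    -- The result type was shifted past the unpacked indices, that is, it does not mention them;
    -- hence all cells get the same type although each box supplies its own indices.
    have := Ty.shift_iinst ιs' (.arr τb ιb)
    rw [Ty.iinst] at this
    rwa [this] at hb
  exact hb'.inst (.cons (hv.eqv (h3.isubst (.inst hι))) .nil)

theorem HasType.collapse {nf nc : List ℕ} {cells : List (Expr B V O)}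
    {ass : List (List (Atom B V O))} {τ' τ : Ty B} {ι : Idx}
    (ht : HasType S Θ Δ Γ (.expr (.frame nf cells (.arr τ' ι))) τ)
    (hι : IdxEqv [] ι (shpLit (nf ++ nc)))
    (h : List.Forall₂ (fun c as => ∃ t, c = Expr.array nc as t ∧
      ∀ a ∈ as, IsValue (.atom a)) cells ass) :
    HasType S Θ Δ Γ (.expr (.array (nf ++ nc) (concat ass) (.arr τ' ι))) τ := by
  obtain ⟨τ1, ι1, hτ, hcells, hk, hl, htag⟩ := ht.frame_inv
  obtain ⟨hk, hι1⟩ := kinded_arr.1 hk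
  have hι := hι.of_closed Θ
  obtain ⟨h1, h2⟩ := htag.arr_inv (hι.symm.sorted (sorted_shpLit _ _))
  -- The cell dimensions are compared with `ι1` through the tag, not through the cells: a frame with
  -- a zero dimension has no cells to inspect.
  have hres : TEqv Θ (.arr τ1 (.append [shpLit nf, ι1])) (.arr τ1 (shpLit (nf ++ nc))) :=
    .arr (.refl _) (h2.symm.trans hι)
  have hcell : ∀ as ∈ ass, as.length = nc.prod ∧ ∀ a ∈ as, HasType S Θ Δ Γ (.atom a) τ1 := by
    intro as has
    obtain ⟨_, hmem, t, rfl, -⟩ := exists_mem_left_of_forall₂ h as has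
    obtain ⟨τ2, hτ2, hat, -, hlen, -⟩ := (hcells _ hmem).array_inv
    exact ⟨hlen, fun a ha => (hat a ha).eqv (hτ2.arr_inv hι1).1⟩
  refine .eqv (.array (fun a ha => ?_) hk ?_ (htag.trans hres)) (hτ.trans hres)
  · obtain ⟨as, has, ha⟩ := List.mem_flatten.1 ha
    exact (hcell as has).2 a ha
  · rw [length_concat fun as has => (hcell as has).1, ← h.length_eq, hl, List.prod_append]

-- Induction on reduction steps.

theorem HasType.step {δ : O → List (Expr B V O) → Option (Expr B V O)} (hδ : DeltaSound S δ)
    (hwf : WfEnv Θ Δ Γ) {e e' : Expr B V O} {τ : Ty B} (ht : HasType S Θ Δ Γ (.expr e) τ)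
    (hs : Step δ e e') : HasType S Θ Δ Γ (.expr e') τ := by
  -- Evaluation contexts never enter a binder, so the environment stays fixed and only the type has
  -- to vary with the subterm.
  induction hs generalizing τ with
  | lift _ hargs hmem hmax _ => exact ht.lift hargs hmem hmax
  | map _ hargs hframe _ => exact ht.map hargs hframe
  | beta _ hargs hframe => exact ht.beta hargs hframe
  | delta hargs hframe hr => exact ht.delta hδ hwf hargs hframe hr
  | tbeta h => exact ht.tbeta hwf h
  | ibeta h => exact ht.ibeta hwf h
  | unbox h => exact ht.unbox_array hwf h
  | collapse hι h => exact ht.collapse hι h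
  | @inBox ns as as' ιs e e' σ tag tag' _ _ ih =>
    obtain ⟨τ', hτ, ha, hk, hl, htag⟩ := ht.array_inv
    refine .eqv (.array (fun a h => ?_) hk (by simpa using hl) htag) hτ
    rcases List.mem_append.1 h with h | h
    · exact ha a (by simp [h])
    · rcases List.mem_cons.1 h with rfl | h
      · obtain ⟨γs, τs, rfl, hτ', hι, hk', he, htag'⟩ := (ha (.box ιs e σ tag') (by simp)).box_inv
        exact .eqv (.box hι hk' (ih he) htag') hτ'
      · exact ha a (by simp [h])
  | @inFrame ns es es' e e' tag _ _ ih =>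
    obtain ⟨τ', ι, hτ, he, hk, hl, htag⟩ := ht.frame_inv
    refine .eqv (.frame (fun a h => ?_) hk (by simpa using hl) htag) hτ
    rcases List.mem_append.1 h with h | h
    · exact he a (by simp [h])
    · rcases List.mem_cons.1 h with rfl | h
      · exact ih (he e (by simp))
      · exact he a (by simp [h])
  | inFun _ ih =>
    obtain ⟨ps, τo, ιo, ιf, ιp, hτ, hf, hl, he, hp, htag⟩ := ht.app_inv
    exact .eqv (.app (ih hf) hl he hp htag) hτ
  | @inArg f e e' es es' tag _ _ _ ih =>
    obtain ⟨ps, τo, ιo, ιf, ιp, hτ, hf, hl, he, hp, htag⟩ := ht.app_inv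
    refine .eqv (.app hf (by simpa using hl) (fun i a p ha hp => ?_) hp htag) hτ
    -- Only the argument at position `es.length` has changed; before and after it the two argument
    -- lists have the same entries.
    rcases lt_trichotomy i es.length with hi | rfl | hi
    · rw [List.getElem?_append_left hi] at ha
      exact he i a p (by rwa [List.getElem?_append_left hi]) hp
    · simp only [List.getElem?_append_right le_rfl, Nat.sub_self, List.getElem?_cons_zero,
        Option.some.injEq] at ha
      subst ha
      exact ih (he _ e p (by simp) hp)
    · obtain ⟨j, rfl⟩ := Nat.exists_eq_add_of_lt hi
      refine he _ a p ?_ hp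
      rw [List.getElem?_append_right (by omega)] at ha ⊢
      rw [show es.length + j + 1 - es.length = j + 1 by omega] at ha ⊢
      simpa using ha
  | inTApp _ ih =>
    obtain ⟨ks, τu, ιu, ιf, hτ, hf, ha, htag⟩ := ht.tapp_inv
    exact .eqv (.tapp (ih hf) ha htag) hτ
  | inIApp _ ih =>
    obtain ⟨γs, τp, ιp, ιf, hτ, hf, ha, htag⟩ := ht.iapp_inv
    exact .eqv (.iapp (ih hf) ha htag) hτ
  | inUnbox _ ih =>
    obtain ⟨γs, τs, τb, ιs, ιb, hτ, hs, hn, hb, hk, htag⟩ := ht.unbox_inv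
    exact .eqv (.unbox (ih hs) hn hb hk htag) hτ

end Preservation

end Remora

theorem mainTheorem3 {B : Type*} {V : Type*} {O : Type*}
    (S : Remora.Signature B V O)
    (δ : O → List (Remora.Expr B V O) → Option (Remora.Expr B V O))
    (hδ : Remora.DeltaSound S δ)
    (Θ : List Remora.Srt) (Δ : List Remora.Kind) (Γ : List (Remora.Ty B))
    (hwf : Remora.WfEnv Θ Δ Γ)
    (e e' : Remora.Expr B V O) (τ : Remora.Ty B)
    (ht : Remora.HasType S Θ Δ Γ (.expr e) τ)
    (hs : Remora.Step δ e e') :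
    Remora.HasType S Θ Δ Γ (.expr e') τ := by
  exact ht.step hδ hwf hs
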